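/- Fix an integer $d\ge 2$. For each $n\ge 1$ let $(\xi_1,\dots,\xi_n)=(\xi^{(n)}_1,\dots,\xi^{(n)}_n)$ be a tuple of random vectors in $\mathbb{R}^d$, defined on a probability space that may depend on $n$. Put $S_k=\xi_1+\dots+\xi_k$ for $1\le k\le n$ and $S_n^*=\xi_1+\dots+\xi_{n-1}-\xi_n$. Suppose that one of the following three cases holds for all sufficiently large $n$. (Case $A_{n-1}$) $n\ge d+1$; $(\xi_1,\dots,\xi_n)\stackrel{d}{=}(\xi_{\sigma(1)},\dots,\xi_{\sigma(n)})$ for every permutation $\sigma$ of $\{1,\dots,n\}$; $S_n=0$ a.s.; and any $d$ random vectors among $S_1,\dots,S_{n-1}$ are linearly independent a.s. In this case put $H_{n,d}=\operatorname{Conv}(S_1,\dots,S_{n-1})$. (Case $B_n$) $n\ge d$; $(\xi_1,\dots,\xi_n)\stackrel{d}{=}(\varepsilon_1\xi_{\sigma(1)},\dots,\varepsilon_n\xi_{\sigma(n)})$ for every permutation $\sigma$ and all $\varepsilon_1,\dots,\varepsilon_n\in\{-1,1\}$; and any $d$ random vectors among $S_1,\dots,S_n$ are linearly independent a.s. In this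 case put $H_{n,d}=\operatorname{Conv}(S_1,\dots,S_n)$. (Case $D_n$) $n\ge\max\{2,d\}$; $(\xi_1,\dots,\xi_n)\stackrel{d}{=}(\varepsilon_1\xi_{\sigma(1)},\dots,\varepsilon_n\xi_{\sigma(n)})$ for every permutation $\sigma$ and all $\varepsilon_1,\dots,\varepsilon_n\in\{-1,1\}$ with $\varepsilon_1\cdots\varepsilon_n=1$; and any $d$ random vectors from either collection $S_1,\dots,S_n$ or $S_1,\dots,S_{n-1},S_n^*$ are linearly independent a.s. In this case put $H_{n,d}=\operatorname{Conv}(S_1,\dots,S_{n-1},S_n,S_n^*)$. Then, as $n\to\infty$, $$ \mathbb{P}[0\notin H_{n,d}]\sim \begin{cases} \dfrac{2(\log n)^{d-1}}{(d-1)!\,n}, & \text{in the case } A_{n-1},\\[2ex] \dfrac{(\log n)^{d-1}}{2^{d-2}(d-1)!\sqrt{\pi n}}, & \text{in the cases } B_n \text{ and } D_n, \end{cases} $$ where $x_n\sim y_n$ means $\lim_{n\to\infty}x_n/y_n=1$. -/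

import Mathlib

namespace WalkHull

/-- The partial sum `S_k = ξ_1 + ⋯ + ξ_k` of the tuple `(ξ_1, …, ξ_n)`; the increment `ξ_{i+1}` is
stored at index `i : Fin n`. -/
def partialSum {n d : ℕ} {Ω : Type*} (ξ : Fin n → Ω → EuclideanSpace ℝ (Fin d)) (k : ℕ) (ω : Ω) :
    EuclideanSpace ℝ (Fin d) :=
  ∑ i ∈ Finset.univ.filter (fun i : Fin n => (i : ℕ) < k), ξ i ω

/-- The sum with the last sign reversed, `S_n^* = ξ_1 + ⋯ + ξ_{n-1} - ξ_n`. -/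
def flippedSum {n d : ℕ} {Ω : Type*} (ξ : Fin n → Ω → EuclideanSpace ℝ (Fin d)) (ω : Ω) :
    EuclideanSpace ℝ (Fin d) :=
  ∑ i : Fin n, if (i : ℕ) + 1 = n then -ξ i ω else ξ i ω

/-- Any `d` random vectors (with distinct indices) of the collection `(V_k)_{k ∈ I}` of random
vectors in `ℝ^d` are almost surely linearly independent. -/
def InGeneralPosition {d : ℕ} {Ω : Type*} [MeasurableSpace Ω] (P : MeasureTheory.Measure Ω)
    (I : Set ℕ) (V : ℕ → Ω → EuclideanSpace ℝ (Fin d)) : Prop :=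
  ∀ s : Fin d → ℕ, Function.Injective s → (∀ j, s j ∈ I) →
    ∀ᵐ ω ∂P, LinearIndependent ℝ (fun j => V (s j) ω)

/-- Assumptions in the `A_{n-1}` case (random walk bridges): the increments are exchangeable,
`S_n = 0` a.s., `n ≥ d + 1`, and any `d` vectors among `S_1, …, S_{n-1}` are a.s. linearly
independent. -/
structure TypeA {n d : ℕ} {Ω : Type*} [MeasurableSpace Ω] (P : MeasureTheory.Measure Ω)
    (ξ : Fin n → Ω → EuclideanSpace ℝ (Fin d)) : Prop where
  measurable : ∀ i, Measurable (ξ i)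
  exchangeable : ∀ σ : Equiv.Perm (Fin n),
    ProbabilityTheory.IdentDistrib (fun ω i => ξ i ω) (fun ω i => ξ (σ i) ω) P P
  sum_eq_zero : ∀ᵐ ω ∂P, partialSum ξ n ω = 0
  dim_le : d + 1 ≤ n
  generalPosition : InGeneralPosition P (Set.Icc 1 (n - 1)) (partialSum ξ)

/-- Assumptions in the `B_n` case (symmetric random walks): the increments are symmetrically
exchangeable, `n ≥ d`, and any `d` vectors among `S_1, …, S_n` are a.s. linearly independent.
Signs are elements of `ℤˣ = {1, -1}`. -/
structure TypeB {n d : ℕ} {Ω : Type*} [MeasurableSpace Ω] (P : MeasureTheory.Measure Ω)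
    (ξ : Fin n → Ω → EuclideanSpace ℝ (Fin d)) : Prop where
  measurable : ∀ i, Measurable (ξ i)
  symmExchangeable : ∀ (σ : Equiv.Perm (Fin n)) (ε : Fin n → ℤˣ),
    ProbabilityTheory.IdentDistrib (fun ω i => ξ i ω) (fun ω i => ε i • ξ (σ i) ω) P P
  dim_le : d ≤ n
  generalPosition : InGeneralPosition P (Set.Icc 1 n) (partialSum ξ)

/-- Assumptions in the `D_n` case: the law of the increments is invariant under permutations
combined with an even number of sign changes, `n ≥ max {2, d}`, and any `d` vectors from either
collection `S_1, …, S_n` or `S_1, …, S_{n-1}, S_n^*` are a.s. linearly independent. -/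
structure TypeD {n d : ℕ} {Ω : Type*} [MeasurableSpace Ω] (P : MeasureTheory.Measure Ω)
    (ξ : Fin n → Ω → EuclideanSpace ℝ (Fin d)) : Prop where
  measurable : ∀ i, Measurable (ξ i)
  evenSymmExchangeable : ∀ (σ : Equiv.Perm (Fin n)) (ε : Fin n → ℤˣ), ∏ i, ε i = 1 →
    ProbabilityTheory.IdentDistrib (fun ω i => ξ i ω) (fun ω i => ε i • ξ (σ i) ω) P P
  dim_le : max 2 d ≤ n
  generalPosition : InGeneralPosition P (Set.Icc 1 n) (partialSum ξ)
  generalPosition_flipped : InGeneralPosition P (Set.Icc 1 n)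
    (Function.update (partialSum ξ) n (flippedSum ξ))

/-- `Conv(S_1, …, S_{n-1})`. -/
def hullA {n d : ℕ} {Ω : Type*} (ξ : Fin n → Ω → EuclideanSpace ℝ (Fin d)) (ω : Ω) :
    Set (EuclideanSpace ℝ (Fin d)) :=
  convexHull ℝ ((fun k => partialSum ξ k ω) '' Set.Icc 1 (n - 1))

/-- `Conv(S_1, …, S_n)`. -/
def hullB {n d : ℕ} {Ω : Type*} (ξ : Fin n → Ω → EuclideanSpace ℝ (Fin d)) (ω : Ω) :
    Set (EuclideanSpace ℝ (Fin d)) :=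
  convexHull ℝ ((fun k => partialSum ξ k ω) '' Set.Icc 1 n)

/-- `Conv(S_1, …, S_{n-1}, S_n, S_n^*)`. -/
def hullD {n d : ℕ} {Ω : Type*} (ξ : Fin n → Ω → EuclideanSpace ℝ (Fin d)) (ω : Ω) :
    Set (EuclideanSpace ℝ (Fin d)) :=
  convexHull ℝ (insert (flippedSum ξ ω) ((fun k => partialSum ξ k ω) '' Set.Icc 1 n))

end WalkHull

/-! The probability of missing the origin does not depend on the law of the increments. By
exchangeability, the probability that the hull contains 0 is unchanged when the walk is rearranged
by a permutation (case A) or a signed permutation (case B), so it equals the average over the group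
of the number of rearrangements whose hull contains 0. In general position this number is a
constant.

To count, note first that in general position 0 lies in the hull only if it is a combination of all
the partial sums with strictly positive weights (`SumsGeneric.exists_pos_combination`). Summation by
parts turns such a combination into a linear relation between the increments with strictly
decreasing coefficients, also positive in case B. Hence the rearrangement by `g` counts exactly when
the open Weyl chamber labelled by `g` meets the space of linear relations between the increments.
The good rearrangements are therefore the regions that the reflection arrangement cuts out in a
generic subspace of codimension `d` (`ncard_signedChamber`, `ncard_permChamber`). Deletion and
restriction on the hyperplanes involving the last coordinate gives a Pascal-type recursion in `n`
and `d` for their number (`ncard_regions_arrangement`).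

In case D, $S_n+S_n^*=2S_{n-1}$ shows that 0 is in the hull iff it is in the hull of the walk or of
the walk with last step reversed, and that it is in both iff it is in the hull of the first $n-1$
sums. The signed permutations split between the laws of the two walks, so inclusion–exclusion
expresses the answer through case B with $n$ and with $n-1$ steps.

For the asymptotics, the miss probabilities are divided by the solution of the homogeneous recursion
($1/n$ in case A, a Wallis product of order $1/\sqrt{\pi n}$ in case B). What remains is
$u_{k+1}(n+1)=u_{k+1}(n)+a_nu_k(n)$ with $na_n\to\alpha$, and Stolz–Cesàro gives $u_k(n)\sim
C\alpha^k(\log n)^k/k!$ (`tendsto_div_log_pow`). -/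

namespace WalkHull

/-! ### Regions of a hyperplane arrangement in a subspace: deletion and restriction. -/

section Regions

open Filter Topology

variable {V : Type*} [AddCommGroup V] [Module ℝ V]

/-- The points of `W` lying on none of the hyperplanes `f = 0`, `f ∈ s`. -/
def genericPoints (s : Set (V →ₗ[ℝ] ℝ)) (W : Submodule ℝ V) : Set V :=
  {v | v ∈ W ∧ ∀ f ∈ s, f v ≠ 0}

/-- The functionals of `s` that are positive at `v`. -/
def signPattern (s : Set (V →ₗ[ℝ] ℝ)) (v : V) : Set (V →ₗ[ℝ] ℝ) :=
  {f | f ∈ s ∧ 0 < f v}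

/-- The regions cut out in the subspace `W` by the hyperplanes `f = 0`, `f ∈ s`. -/
def regions (s : Set (V →ₗ[ℝ] ℝ)) (W : Submodule ℝ V) : Set (Set (V →ₗ[ℝ] ℝ)) :=
  signPattern s '' genericPoints s W

lemma signPattern_eq_iff {s : Set (V →ₗ[ℝ] ℝ)} {v w : V} :
    signPattern s v = signPattern s w ↔ ∀ f ∈ s, (0 < f v ↔ 0 < f w) := by
  constructor
  · intro h f hf
    have := Set.ext_iff.1 h f
    simpa [signPattern, hf] using this
  · intro h
    ext f
    simp only [signPattern, Set.mem_ofPred_eq]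
    constructor
    · rintro ⟨a, b⟩; exact ⟨a, (h f a).1 b⟩
    · rintro ⟨a, b⟩; exact ⟨a, (h f a).2 b⟩

lemma ncard_image_eq_of_eq_iff {X α β : Type*} {S : Set X} {f : X → α} {g : X → β}
    (h : ∀ x ∈ S, ∀ y ∈ S, f x = f y ↔ g x = g y) : (f '' S).ncard = (g '' S).ncard := by
  classical
  refine Set.ncard_congr (fun a ha => g ha.choose) ?_ ?_ ?_
  · intro a ha
    exact ⟨_, ha.choose_spec.1, rfl⟩
  · intro a b ha hb hab
    rw [← ha.choose_spec.2, ← hb.choose_spec.2]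
    exact (h _ ha.choose_spec.1 _ hb.choose_spec.1).2 hab
  · rintro _ ⟨x, hx, rfl⟩
    have hfx : f x ∈ f '' S := ⟨x, hx, rfl⟩
    refine ⟨f x, hfx, ?_⟩
    exact (h _ hfx.choose_spec.1 _ hx).1 hfx.choose_spec.2

lemma regions_finite {s : Set (V →ₗ[ℝ] ℝ)} (hs : s.Finite) (W : Submodule ℝ V) :
    (regions s W).Finite := by
  refine hs.finite_subsets.subset ?_
  rintro _ ⟨v, -, rfl⟩
  exact fun f hf => hf.1

lemma eventually_same_sign {s : Set (V →ₗ[ℝ] ℝ)} (hs : s.Finite) {v : V}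
    (hv : ∀ f ∈ s, f v ≠ 0) (w : V) :
    ∀ᶠ t : ℝ in 𝓝 0, ∀ f ∈ s, f (v + t • w) ≠ 0 ∧ (0 < f (v + t • w) ↔ 0 < f v) := by
  rw [hs.eventually_all]
  intro f hf
  have hc : Tendsto (fun t : ℝ => f (v + t • w)) (𝓝 0) (𝓝 (f v)) := by
    have : Continuous fun t : ℝ => f (v + t • w) := by
      simp only [map_add, map_smul, smul_eq_mul]; fun_prop
    simpa using this.tendsto 0
  rcases lt_or_gt_of_ne (hv f hf) with h | h
  · filter_upwards [hc.eventually (gt_mem_nhds h)] with t ht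
    exact ⟨ht.ne, by constructor <;> intro <;> linarith⟩
  · filter_upwards [hc.eventually (lt_mem_nhds h)] with t ht
    exact ⟨ht.ne', iff_of_true ht h⟩

/-- A small move along $\pm w$, with $w\in W$ off the hyperplane `f = 0`, changes the sign of `f`
but of no functional in `s`. -/
lemma exists_perturbation {s : Set (V →ₗ[ℝ] ℝ)} (hs : s.Finite) {W : Submodule ℝ V} {v : V}
    (hv : v ∈ genericPoints s W) {f : V →ₗ[ℝ] ℝ} (hf : f v = 0) (hw : ∃ w ∈ W, f w ≠ 0) :
    (∃ u ∈ genericPoints s W, signPattern s u = signPattern s v ∧ 0 < f u) ∧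
      ∃ u ∈ genericPoints s W, signPattern s u = signPattern s v ∧ f u < 0 := by
  obtain ⟨w, hwW, hw⟩ := hw
  obtain ⟨w, hwW, hw⟩ : ∃ w ∈ W, 0 < f w := by
    rcases lt_or_gt_of_ne hw with h | h
    · exact ⟨-w, W.neg_mem hwW, by simpa using h⟩
    · exact ⟨w, hwW, h⟩
  obtain ⟨δ, hδ, hball⟩ := Metric.eventually_nhds_iff.1 (eventually_same_sign hs hv.2 w)
  have key : ∀ t : ℝ, |t| < δ → v + t • w ∈ genericPoints s W ∧
      signPattern s (v + t • w) = signPattern s v ∧ f (v + t • w) = t * f w := by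
    intro t ht
    have := hball (y := t) (by simpa using ht)
    exact ⟨⟨W.add_mem hv.1 (W.smul_mem _ hwW), fun g hg => (this g hg).1⟩,
      signPattern_eq_iff.2 fun g hg => (this g hg).2, by simp [hf]⟩
  have h1 := key (δ / 2) (by rw [abs_of_pos (by positivity)]; linarith)
  have h2 := key (-(δ / 2)) (by rw [abs_neg, abs_of_pos (by positivity)]; linarith)
  refine ⟨⟨_, h1.1, h1.2.1, ?_⟩, ⟨_, h2.1, h2.2.1, ?_⟩⟩
  · rw [h1.2.2]; positivity
  · rw [h2.2.2]; nlinarith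

/-- Deletion and restriction for the number of regions. -/
lemma ncard_regions_insert {s : Set (V →ₗ[ℝ] ℝ)} (hs : s.Finite) (W : Submodule ℝ V)
    (f : V →ₗ[ℝ] ℝ) (hf : (genericPoints s W).Nonempty → ∃ w ∈ W, f w ≠ 0) :
    (regions (insert f s) W).ncard =
      (regions s W).ncard + (regions s (W ⊓ LinearMap.ker f)).ncard := by
  by_cases hfs : f ∈ s
  · have h0 : regions s (W ⊓ LinearMap.ker f) = ∅ := by
      rw [regions, Set.image_eq_empty, Set.eq_empty_iff_forall_notMem]
      rintro v ⟨⟨-, hv⟩, h⟩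
      exact h f hfs hv
    simp [h0, Set.insert_eq_of_mem hfs]
  -- `Rp` and `Rn` are the old regions reaching the two sides of `f = 0`. The new regions number
  -- `Rp.ncard + Rn.ncard`; the union is all old regions and the intersection is those that the
  -- hyperplane crosses.
  set Rp : Set (Set (V →ₗ[ℝ] ℝ)) := signPattern s '' {v | v ∈ genericPoints s W ∧ 0 < f v} with hRp
  set Rn : Set (Set (V →ₗ[ℝ] ℝ)) := signPattern s '' {v | v ∈ genericPoints s W ∧ f v < 0} with hRn
  have hRps : Rp ⊆ regions s W := Set.image_mono fun v hv => hv.1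
  have hRns : Rn ⊆ regions s W := Set.image_mono fun v hv => hv.1
  have hfin := regions_finite hs W
  have h1 : regions (insert f s) W = (insert f '' Rp) ∪ Rn := by
    ext p
    constructor
    · rintro ⟨v, ⟨hvW, hv⟩, rfl⟩
      have hfv := hv f (Set.mem_insert _ _)
      have hg : v ∈ genericPoints s W := ⟨hvW, fun g hg => hv g (Set.mem_insert_of_mem _ hg)⟩
      rcases lt_or_gt_of_ne hfv with h | h
      · right
        refine ⟨v, ⟨hg, h⟩, ?_⟩
        ext g
        simp only [signPattern, Set.mem_ofPred_eq, Set.mem_insert_iff]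
        constructor
        · rintro ⟨a, b⟩; exact ⟨Or.inr a, b⟩
        · rintro ⟨rfl | a, b⟩
          · linarith
          · exact ⟨a, b⟩
      · left
        refine ⟨_, ⟨v, ⟨hg, h⟩, rfl⟩, ?_⟩
        ext g
        simp only [signPattern, Set.mem_ofPred_eq, Set.mem_insert_iff]
        constructor
        · rintro (rfl | ⟨a, b⟩)
          · exact ⟨Or.inl rfl, h⟩
          · exact ⟨Or.inr a, b⟩
        · rintro ⟨rfl | a, b⟩
          · exact Or.inl rfl
          · exact Or.inr ⟨a, b⟩
    · rintro (⟨_, ⟨v, ⟨⟨hvW, hv⟩, h⟩, rfl⟩, rfl⟩ | ⟨v, ⟨⟨hvW, hv⟩, h⟩, rfl⟩)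
      · refine ⟨v, ⟨hvW, ?_⟩, ?_⟩
        · rintro g (rfl | hg)
          · exact h.ne'
          · exact hv g hg
        ext g
        simp only [signPattern, Set.mem_ofPred_eq, Set.mem_insert_iff]
        constructor
        · rintro ⟨rfl | a, b⟩
          · exact Or.inl rfl
          · exact Or.inr ⟨a, b⟩
        · rintro (rfl | ⟨a, b⟩)
          · exact ⟨Or.inl rfl, h⟩
          · exact ⟨Or.inr a, b⟩
      · refine ⟨v, ⟨hvW, ?_⟩, ?_⟩
        · rintro g (rfl | hg)
          · exact h.ne
          · exact hv g hg
        ext g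
        simp only [signPattern, Set.mem_ofPred_eq, Set.mem_insert_iff]
        constructor
        · rintro ⟨rfl | a, b⟩
          · linarith
          · exact ⟨a, b⟩
        · rintro ⟨a, b⟩; exact ⟨Or.inr a, b⟩
  have hnot : ∀ p ∈ regions s W, f ∉ p := by
    rintro _ ⟨v, -, rfl⟩ h
    exact hfs h.1
  have h2 : (regions (insert f s) W).ncard = Rp.ncard + Rn.ncard := by
    rw [h1, Set.ncard_union_eq _ ((hfin.subset hRps).image _) (hfin.subset hRns),
      Set.InjOn.ncard_image]
    · intro p hp q hq hpq
      have hp' := hnot p (hRps hp)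
      have hq' := hnot q (hRps hq)
      have : insert f p \ {f} = insert f q \ {f} := by rw [hpq]
      rwa [Set.insert_sdiff_self_of_notMem hp', Set.insert_sdiff_self_of_notMem hq'] at this
    · rw [Set.disjoint_left]
      rintro _ ⟨p, hp, rfl⟩ hn
      exact hnot _ (hRns hn) (Set.mem_insert _ _)
  have h3 : Rp ∪ Rn = regions s W := by
    apply Set.Subset.antisymm (Set.union_subset hRps hRns)
    rintro _ ⟨v, hv, rfl⟩
    rcases lt_trichotomy (f v) 0 with h | h | h
    · exact Or.inr ⟨v, ⟨hv, h⟩, rfl⟩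
    · obtain ⟨⟨u, hu, hus, hfu⟩, -⟩ := exists_perturbation hs hv h (hf ⟨v, hv⟩)
      exact Or.inl ⟨u, ⟨hu, hfu⟩, hus⟩
    · exact Or.inl ⟨v, ⟨hv, h⟩, rfl⟩
  have h4 : Rp ∩ Rn = regions s (W ⊓ LinearMap.ker f) := by
    ext p
    constructor
    · rintro ⟨⟨v, ⟨hv, hfv⟩, rfl⟩, ⟨w, ⟨hw, hfw⟩, hwv⟩⟩
      have hsg := signPattern_eq_iff.1 hwv
      have hsgn : ∀ g ∈ s, 0 < g v * g w := by
        intro g hg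
        rcases lt_or_gt_of_ne (hv.2 g hg) with h | h
        · have : g w < 0 := lt_of_le_of_ne
            (not_lt.1 fun h' => by have := (hsg g hg).1 h'; linarith) (hw.2 g hg)
          exact mul_pos_of_neg_of_neg h this
        · exact mul_pos h ((hsg g hg).2 h)
      -- Since $f(w)<0<f(v)$ this is a positive combination of two points of one convex region,
      -- weighted so as to lie on `f = 0`.
      have hcomb : ∀ g ∈ s, g ((-f w) • v + f v • w) ≠ 0 ∧
          (0 < g ((-f w) • v + f v • w) ↔ 0 < g v) := by
        intro g hg
        have h := hsgn g hg
        simp only [map_add, map_smul, smul_eq_mul]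
        rcases lt_or_gt_of_ne (hv.2 g hg) with h' | h'
        · have hgw : g w < 0 := by nlinarith
          have : -f w * g v + f v * g w < 0 := by nlinarith
          exact ⟨this.ne, by constructor <;> intro <;> linarith⟩
        · have hgw : 0 < g w := by nlinarith
          have : 0 < -f w * g v + f v * g w := by nlinarith
          exact ⟨this.ne', iff_of_true this h'⟩
      refine ⟨(-f w) • v + f v • w, ⟨⟨W.add_mem (W.smul_mem _ hv.1) (W.smul_mem _ hw.1), ?_⟩,
        fun g hg => (hcomb g hg).1⟩, signPattern_eq_iff.2 fun g hg => (hcomb g hg).2⟩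
      simp [LinearMap.mem_ker]; ring
    · rintro ⟨v, ⟨⟨hvW, hfv⟩, hv⟩, rfl⟩
      have hv' : v ∈ genericPoints s W := ⟨hvW, hv⟩
      obtain ⟨⟨u, hu, hus, hfu⟩, ⟨u', hu', hus', hfu'⟩⟩ :=
        exists_perturbation hs hv' hfv (hf ⟨v, hv'⟩)
      exact ⟨⟨u, ⟨hu, hfu⟩, hus⟩, ⟨u', ⟨hu', hfu'⟩, hus'⟩⟩
  rw [h2, ← h3, ← h4, Set.ncard_union_add_ncard_inter _ _ (hfin.subset hRps) (hfin.subset hRns)]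

/-- Inside `W` the new hyperplane coincides with one already present. -/
lemma ncard_regions_insert_of_smul {s : Set (V →ₗ[ℝ] ℝ)} {W : Submodule ℝ V}
    {f g : V →ₗ[ℝ] ℝ} (hg : g ∈ s) {c : ℝ} (hc : c ≠ 0) (hfg : ∀ v ∈ W, f v = c * g v) :
    (regions (insert f s) W).ncard = (regions s W).ncard := by
  have hgen : genericPoints (insert f s) W = genericPoints s W := by
    ext v
    constructor
    · rintro ⟨a, b⟩; exact ⟨a, fun k hk => b k (Set.mem_insert_of_mem _ hk)⟩
    · rintro ⟨a, b⟩
      refine ⟨a, ?_⟩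
      rintro k (rfl | hk)
      · rw [hfg v a]; exact mul_ne_zero hc (b g hg)
      · exact b k hk
  rw [regions, regions, hgen]
  refine ncard_image_eq_of_eq_iff fun x hx y hy => ?_
  rw [signPattern_eq_iff, signPattern_eq_iff]
  constructor
  · exact fun h k hk => h k (Set.mem_insert_of_mem _ hk)
  · rintro h k (rfl | hk)
    · rw [hfg x hx.1, hfg y hy.1]
      have h1 := h g hg
      have hx0 := hx.2 g hg
      have hy0 := hy.2 g hg
      rcases lt_or_gt_of_ne hc with hc | hc
      · rw [← neg_mul_neg, ← neg_mul_neg c, mul_pos_iff_of_pos_left (by linarith),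
          mul_pos_iff_of_pos_left (by linarith)]
        constructor
        · intro h'
          by_contra h''
          have := h1.2 (lt_of_le_of_ne (by linarith) hy0.symm)
          linarith
        · intro h'
          by_contra h''
          have := h1.1 (lt_of_le_of_ne (by linarith) hx0.symm)
          linarith
      · rw [mul_pos_iff_of_pos_left hc, mul_pos_iff_of_pos_left hc, h1]
    · exact h k hk

/-- Adding to an arrangement a family of hyperplanes whose pairwise intersections lie in the
hyperplanes of the arrangement. -/
lemma ncard_regions_union_range {β : Type*} [Fintype β] {s : Set (V →ₗ[ℝ] ℝ)} (hs : s.Finite)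
    (W : Submodule ℝ V) (h : β → V →ₗ[ℝ] ℝ)
    (hne : (genericPoints s W).Nonempty → ∀ b, ∃ w ∈ W, h b w ≠ 0)
    (hdiff : ∀ a b, a ≠ b → ∃ g ∈ s, ∃ c : ℝ, c ≠ 0 ∧ ∀ v, h a v - h b v = c * g v) :
    (regions (s ∪ Set.range h) W).ncard =
      (regions s W).ncard + ∑ b, (regions s (W ⊓ LinearMap.ker (h b))).ncard := by
  classical
  -- On the kernel of `h b`, each other `h a` is a nonzero multiple of some `g ∈ s`, so the other
  -- new hyperplanes cut nothing further.
  have restrict : ∀ (t : Finset β) (b : β), b ∉ t →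
      (regions (s ∪ h '' t) (W ⊓ LinearMap.ker (h b))).ncard =
        (regions s (W ⊓ LinearMap.ker (h b))).ncard := by
    intro t b
    induction t using Finset.induction_on with
    | empty => simp
    | insert a t ha ih =>
      intro hb
      rw [Finset.mem_insert, not_or] at hb
      obtain ⟨g, hg, c, hc, hgc⟩ := hdiff a b (Ne.symm hb.1)
      rw [Finset.coe_insert, Set.image_insert_eq, Set.union_insert,
        ncard_regions_insert_of_smul (Or.inl hg) hc, ih hb.2]
      rintro v ⟨-, hv⟩
      have : h b v = 0 := hv
      rw [← hgc, this, sub_zero]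
  have main : ∀ t : Finset β, (regions (s ∪ h '' t) W).ncard =
      (regions s W).ncard + ∑ b ∈ t, (regions s (W ⊓ LinearMap.ker (h b))).ncard := by
    intro t
    induction t using Finset.induction_on with
    | empty => simp
    | insert a t ha ih =>
      rw [Finset.coe_insert, Set.image_insert_eq, Set.union_insert,
        ncard_regions_insert (hs.union (t.finite_toSet.image h)), ih, restrict t a ha,
        Finset.sum_insert ha]
      · ring
      · rintro ⟨v, hv, hv'⟩
        exact hne ⟨v, hv, fun g hg => hv' g (Or.inl hg)⟩ a
  simpa using main Finset.univ

/-- Regions of an arrangement pulled back along a linear map. -/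
lemma ncard_regions_comp {V' : Type*} [AddCommGroup V'] [Module ℝ V'] (T : V →ₗ[ℝ] V')
    (s : Set (V' →ₗ[ℝ] ℝ)) (W : Submodule ℝ V) :
    (regions ((fun f => f ∘ₗ T) '' s) W).ncard = (regions s (W.map T)).ncard := by
  have hgen : genericPoints s (W.map T) = T '' genericPoints ((fun f => f ∘ₗ T) '' s) W := by
    ext v
    constructor
    · rintro ⟨⟨w, hw, rfl⟩, h⟩
      refine ⟨w, ⟨hw, ?_⟩, rfl⟩
      rintro _ ⟨f, hf, rfl⟩
      exact h f hf
    · rintro ⟨w, ⟨hw, h⟩, rfl⟩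
      exact ⟨⟨w, hw, rfl⟩, fun f hf => h _ ⟨f, hf, rfl⟩⟩
  rw [regions, regions, hgen, Set.image_image]
  refine ncard_image_eq_of_eq_iff fun x _ y _ => ?_
  rw [signPattern_eq_iff, signPattern_eq_iff]
  simp

end Regions

/-! ### Counting the regions of the arrangements of types A and B in a generic space of relations.
-/

section Arrangement

open LinearMap

variable {E : Type*} [AddCommGroup E] [Module ℝ E]

/-- The hyperplanes `x_j = 0` and `x_j = ε x_i`, `i < j`, `ε ∈ Sg`, in `ℝ^n`. For `Sg = {1, -1}`
this is the reflection arrangement of type `B_n`; for `Sg = {1}` it is the arrangement of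
type `A_n`, in the coordinates `x_i - x_{n+1}`. -/
def arrangement (Sg : Finset ℝ) (n : ℕ) : Set ((Fin n → ℝ) →ₗ[ℝ] ℝ) :=
  {f | (∃ j, f = proj j) ∨ ∃ i j : Fin n, i < j ∧ ∃ ε ∈ Sg, f = proj j - ε • proj i}

/-- The linear relations `∑ x_i ξ_i ∈ U`. -/
def relSpace {n : ℕ} (ξ : Fin n → E) (U : Submodule ℝ E) : Submodule ℝ (Fin n → ℝ) :=
  U.comap (Fintype.linearCombination ℝ ξ)

lemma mem_relSpace {n : ℕ} {ξ : Fin n → E} {U : Submodule ℝ E} {x : Fin n → ℝ} :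
    x ∈ relSpace ξ U ↔ ∑ i, x i • ξ i ∈ U := by
  simp [relSpace, Fintype.linearCombination_apply]

/-- The space of relations meets every flat of the arrangement in the expected dimension:
identifying some coordinates up to signs in `Sg` and erasing others yields vectors that are either
independent or spanning modulo `U`. -/
def IsGeneric (Sg : Finset ℝ) {n : ℕ} (ξ : Fin n → E) (U : Submodule ℝ E) : Prop :=
  ∀ (r : ℕ) (c : Fin n → Fin r) (s : Fin n → ℝ), (∀ i, s i = 0 ∨ s i ∈ Sg) →
    (∀ j, ∃ i, c i = j ∧ s i ≠ 0) →
    (∀ y : Fin r → ℝ, ∑ i, (s i * y (c i)) • ξ i ∈ U → y = 0) ∨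
      ∀ e : E, ∃ y : Fin r → ℝ, ∑ i, (s i * y (c i)) • ξ i - e ∈ U

/-- Absorb `ε` times the last vector into the `i`-th one. -/
def absorbLast {n : ℕ} (ξ : Fin (n + 1) → E) (i : Fin n) (ε : ℝ) (j : Fin n) : E :=
  ξ j.castSucc + if j = i then ε • ξ (Fin.last n) else 0

lemma sum_absorbLast {n : ℕ} (ξ : Fin (n + 1) → E) (i : Fin n) (ε : ℝ) (x : Fin n → ℝ) :
    ∑ j, x j • absorbLast ξ i ε j =
      ∑ j, x j • ξ j.castSucc + (ε * x i) • ξ (Fin.last n) := by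
  simp [absorbLast, smul_add, Finset.sum_add_distrib, smul_smul, mul_comm]

/-- The functional `x_n - ε x_i` on `ℝ^{n+1}`. -/
def lastSub {n : ℕ} (i : Fin n) (ε : ℝ) : (Fin (n + 1) → ℝ) →ₗ[ℝ] ℝ :=
  proj (Fin.last n) - ε • proj i.castSucc

lemma lastSub_apply {n : ℕ} (i : Fin n) (ε : ℝ) (x : Fin (n + 1) → ℝ) :
    lastSub i ε x = x (Fin.last n) - ε * x i.castSucc := by simp [lastSub]

/-- Forgetting the last coordinate. -/
def initMap (n : ℕ) : (Fin (n + 1) → ℝ) →ₗ[ℝ] (Fin n → ℝ) := funLeft ℝ ℝ Fin.castSucc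

lemma initMap_apply {n : ℕ} (x : Fin (n + 1) → ℝ) (i : Fin n) : initMap n x i = x i.castSucc := rfl

/-- On $x_n=\varepsilon x_i$ the last coordinate is determined by the others, and its vector joins
the `i`-th one. The value `ε = 0` covers the hyperplane $x_n=0$. -/
lemma map_relSpace_inf_ker {n : ℕ} (ξ : Fin (n + 1) → E) (U : Submodule ℝ E) (i : Fin n) (ε : ℝ) :
    (relSpace ξ U ⊓ ker (lastSub i ε)).map (initMap n) = relSpace (absorbLast ξ i ε) U := by
  ext x
  rw [mem_relSpace, sum_absorbLast, Submodule.mem_map]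
  constructor
  · rintro ⟨w, ⟨hw, hk⟩, rfl⟩
    rw [SetLike.mem_coe, mem_relSpace, Fin.sum_univ_castSucc] at hw
    rw [SetLike.mem_coe, mem_ker, lastSub_apply, sub_eq_zero] at hk
    rw [hk] at hw
    simpa [initMap_apply] using hw
  · intro h
    refine ⟨Fin.snoc x (ε * x i), ⟨?_, ?_⟩, ?_⟩
    · rw [SetLike.mem_coe, mem_relSpace, Fin.sum_univ_castSucc]
      simpa using h
    · simp [lastSub_apply]
    · ext j; simp [initMap_apply]

/-- Forgetting the last coefficient leaves a relation known only modulo the last vector. This is why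
relations are taken modulo a subspace `U`, which grows during the induction. -/
lemma map_relSpace {n : ℕ} (ξ : Fin (n + 1) → E) (U : Submodule ℝ E) :
    (relSpace ξ U).map (initMap n) =
      relSpace (fun i => ξ i.castSucc) (U ⊔ Submodule.span ℝ {ξ (Fin.last n)}) := by
  ext x
  rw [mem_relSpace, Submodule.mem_map]
  constructor
  · rintro ⟨w, hw, rfl⟩
    rw [mem_relSpace, Fin.sum_univ_castSucc] at hw
    have : ∑ i : Fin n, w i.castSucc • ξ i.castSucc =
      (∑ i : Fin n, w i.castSucc • ξ i.castSucc + w (Fin.last n) • ξ (Fin.last n)) +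
        (-w (Fin.last n)) • ξ (Fin.last n) := by simp
    simp only [initMap_apply]
    rw [this]
    exact Submodule.add_mem_sup hw (Submodule.smul_mem _ _ (Submodule.mem_span_singleton_self _))
  · intro h
    obtain ⟨u, hu, v, hv, huv⟩ := Submodule.mem_sup.1 h
    obtain ⟨t, rfl⟩ := Submodule.mem_span_singleton.1 hv
    refine ⟨Fin.snoc x (-t), ?_, ?_⟩
    · rw [mem_relSpace, Fin.sum_univ_castSucc]
      simpa [← huv] using hu
    · ext j; simp [initMap_apply]

/-- A signed block structure on the absorbed vectors comes from one on the original vectors: the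
last index is put in the block of `i` with sign `ε * s i`. -/
lemma IsGeneric.absorbLast {Sg : Finset ℝ} (hmul : ∀ a ∈ Sg, ∀ b ∈ Sg, a * b ∈ Sg) {n : ℕ}
    {ξ : Fin (n + 1) → E} {U : Submodule ℝ E} (h : IsGeneric Sg ξ U) (i : Fin n) {ε : ℝ}
    (hε : ε = 0 ∨ ε ∈ Sg) : IsGeneric Sg (absorbLast ξ i ε) U := by
  intro r c s hs hc
  have key : ∀ y : Fin r → ℝ, ∑ j, (s j * y (c j)) • WalkHull.absorbLast ξ i ε j =
      ∑ j, ((Fin.snoc s (ε * s i) : Fin (n + 1) → ℝ) j *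
        y ((Fin.snoc c (c i) : Fin (n + 1) → Fin r) j)) • ξ j := by
    intro y
    rw [sum_absorbLast, Fin.sum_univ_castSucc]
    simp [mul_assoc]
  simp only [key]
  refine h r _ _ ?_ ?_
  · intro j
    refine Fin.lastCases ?_ (fun j => ?_) j
    · simp only [Fin.snoc_last]
      rcases hε with rfl | hε
      · simp
      · rcases hs i with h0 | h1
        · simp [h0]
        · exact Or.inr (hmul _ hε _ h1)
    · simpa using hs j
  · intro j
    obtain ⟨k, hk⟩ := hc j
    exact ⟨k.castSucc, by simpa using hk⟩

/-- The last vector is made a block of its own; its free coefficient accounts for the added span. -/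
lemma IsGeneric.sup_last {Sg : Finset ℝ} (h1 : (1 : ℝ) ∈ Sg) {n : ℕ}
    {ξ : Fin (n + 1) → E} {U : Submodule ℝ E} (h : IsGeneric Sg ξ U) :
    IsGeneric Sg (fun i : Fin n => ξ i.castSucc) (U ⊔ Submodule.span ℝ {ξ (Fin.last n)}) := by
  intro r c s hs hc
  have key : ∀ y : Fin (r + 1) → ℝ, ∑ j, ((Fin.snoc s 1 : Fin (n + 1) → ℝ) j *
        y ((Fin.snoc (fun j => (c j).castSucc) (Fin.last r) : Fin (n + 1) → Fin (r + 1)) j)) • ξ j =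
      ∑ j, (s j * y (c j).castSucc) • ξ j.castSucc + y (Fin.last r) • ξ (Fin.last n) := by
    intro y
    rw [Fin.sum_univ_castSucc]
    simp
  have hmem := Submodule.mem_span_singleton_self (R := ℝ) (ξ (Fin.last n))
  have hs' : ∀ j, (Fin.snoc s 1 : Fin (n + 1) → ℝ) j = 0 ∨
      (Fin.snoc s 1 : Fin (n + 1) → ℝ) j ∈ Sg := by
    intro j
    refine Fin.lastCases ?_ (fun j => ?_) j
    · simp [h1]
    · simpa using hs j
  have hc' : ∀ j, ∃ i, (Fin.snoc (fun j => (c j).castSucc) (Fin.last r) :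
      Fin (n + 1) → Fin (r + 1)) i = j ∧ (Fin.snoc s 1 : Fin (n + 1) → ℝ) i ≠ 0 := by
    intro j
    refine Fin.lastCases ?_ (fun j => ?_) j
    · exact ⟨Fin.last n, by simp⟩
    · obtain ⟨k, hk⟩ := hc j
      exact ⟨k.castSucc, by simpa using hk⟩
  rcases h (r + 1) _ _ hs' hc' with H | H
  · left
    intro y hy
    obtain ⟨u, hu, v, hv, huv⟩ := Submodule.mem_sup.1 hy
    obtain ⟨t, rfl⟩ := Submodule.mem_span_singleton.1 hv
    have := H (Fin.snoc y (-t)) (by rw [key]; simpa [← huv] using hu)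
    ext j
    simpa using congrFun this j.castSucc
  · right
    intro e
    obtain ⟨y, hy⟩ := H e
    refine ⟨fun j => y j.castSucc, ?_⟩
    rw [key] at hy
    have := Submodule.add_mem_sup hy (Submodule.smul_mem _ (-y (Fin.last r)) hmem)
    convert this using 1
    rw [neg_smul]
    abel

lemma IsGeneric.last_notMem {Sg : Finset ℝ} (h1 : (1 : ℝ) ∈ Sg) {n : ℕ}
    {ξ : Fin (n + 1) → E} {U : Submodule ℝ E} (h : IsGeneric Sg ξ U) (hU : U ≠ ⊤) :
    ξ (Fin.last n) ∉ U := by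
  intro hmem
  have hs : ∀ i, (Pi.single (Fin.last n) 1 : Fin (n + 1) → ℝ) i = 0 ∨
      (Pi.single (Fin.last n) 1 : Fin (n + 1) → ℝ) i ∈ Sg := by
    intro i
    rw [Pi.single_apply]
    split_ifs
    · exact Or.inr h1
    · exact Or.inl rfl
  rcases h 1 (fun _ => 0) _ hs
    (fun j => ⟨Fin.last n, Subsingleton.elim _ _, by simp⟩) with H | H
  · have := H (fun _ => 1) (by simpa [Pi.single_apply] using hmem)
    simpa using congrFun this 0
  · refine hU (eq_top_iff.2 fun e _ => ?_)
    obtain ⟨y, hy⟩ := H e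
    have h2 : y 0 • ξ (Fin.last n) - e ∈ U := by simpa [Pi.single_apply] using hy
    exact (Submodule.sub_mem_iff_right _ (U.smul_mem _ hmem)).1 h2

lemma arrangement_finite (Sg : Finset ℝ) (n : ℕ) : (arrangement Sg n).Finite := by
  have : arrangement Sg n ⊆ Set.range (fun j => proj j) ∪
      (fun t : (Fin n × Fin n) × ℝ =>
        (proj t.1.2 - t.2 • proj t.1.1 : (Fin n → ℝ) →ₗ[ℝ] ℝ)) '' (Set.univ ×ˢ (Sg : Set ℝ)) := by
    rintro f (⟨j, rfl⟩ | ⟨i, j, -, ε, hε, rfl⟩)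
    · exact Or.inl ⟨j, rfl⟩
    · exact Or.inr ⟨((i, j), ε), ⟨trivial, hε⟩, rfl⟩
  refine Set.Finite.subset ?_ this
  exact (Set.finite_range _).union ((Set.finite_univ.prod Sg.finite_toSet).image _)

/-- The functionals of the arrangement involving the last coordinate. -/
def lastFunctional (Sg : Finset ℝ) (n : ℕ) :
    Option (Fin (n + 1) × Sg) → (Fin (n + 2) → ℝ) →ₗ[ℝ] ℝ
  | none => lastSub 0 0
  | some p => lastSub p.1 p.2

lemma arrangement_succ (Sg : Finset ℝ) (n : ℕ) :
    arrangement Sg (n + 2) = (fun f => f ∘ₗ initMap (n + 1)) '' arrangement Sg (n + 1) ∪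
      Set.range (lastFunctional Sg n) := by
  ext f
  constructor
  · rintro (⟨j, rfl⟩ | ⟨i, j, hij, ε, hε, rfl⟩)
    · refine Fin.lastCases ?_ (fun j => ?_) j
      · exact Or.inr ⟨none, by simp [lastFunctional, lastSub]⟩
      · exact Or.inl ⟨proj j, Or.inl ⟨j, rfl⟩, rfl⟩
    · revert hij
      refine Fin.lastCases (fun hij => ?_) (fun j hij => ?_) j
      · obtain ⟨i, rfl⟩ := Fin.exists_castSucc_eq.2 hij.ne
        exact Or.inr ⟨some (i, ⟨ε, hε⟩), rfl⟩
      · obtain ⟨i, rfl⟩ := Fin.exists_castSucc_eq.2 (hij.trans (Fin.castSucc_lt_last j)).ne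
        exact Or.inl ⟨proj j - ε • proj i, Or.inr ⟨i, j, by simpa using hij, ε, hε, rfl⟩, rfl⟩
  · rintro (⟨_, ⟨j, rfl⟩ | ⟨i, j, hij, ε, hε, rfl⟩, rfl⟩ | ⟨_ | ⟨i, ε⟩, rfl⟩)
    · exact Or.inl ⟨j.castSucc, rfl⟩
    · exact Or.inr ⟨i.castSucc, j.castSucc, by simpa using hij, ε, hε, rfl⟩
    · exact Or.inl ⟨Fin.last _, by simp [lastFunctional, lastSub]⟩
    · exact Or.inr ⟨i.castSucc, Fin.last _, Fin.castSucc_lt_last i, ε, ε.2, rfl⟩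

/-- The last coordinate cancels in the difference, and $\delta x_j-\varepsilon
x_i=\delta(x_j-\varepsilon\delta x_i)$ because $\delta^2=1$. This feeds `ncard_regions_union_range`.
-/
lemma lastFunctional_sub {Sg : Finset ℝ} (hmul : ∀ a ∈ Sg, ∀ b ∈ Sg, a * b ∈ Sg)
    (hsq : ∀ a ∈ Sg, a * a = 1) (n : ℕ) (a b : Option (Fin (n + 1) × Sg)) (hab : a ≠ b) :
    ∃ g ∈ (fun f => f ∘ₗ initMap (n + 1)) '' arrangement Sg (n + 1), ∃ c : ℝ, c ≠ 0 ∧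
      ∀ v, lastFunctional Sg n a v - lastFunctional Sg n b v = c * g v := by
  have hne : ∀ ε : Sg, (ε : ℝ) ≠ 0 := fun ε h => by simpa [h] using hsq ε ε.2
  rcases a with _ | ⟨i, ε⟩ <;> rcases b with _ | ⟨j, δ⟩
  · exact absurd rfl hab
  · refine ⟨_, ⟨proj j, Or.inl ⟨j, rfl⟩, rfl⟩, δ, hne δ, fun v => ?_⟩
    simp [lastFunctional, lastSub_apply, initMap_apply]
  · refine ⟨_, ⟨proj i, Or.inl ⟨i, rfl⟩, rfl⟩, -ε, neg_ne_zero.2 (hne ε), fun v => ?_⟩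
    simp [lastFunctional, lastSub_apply, initMap_apply]
  · rcases lt_trichotomy i j with h | rfl | h
    · refine ⟨_, ⟨_, Or.inr ⟨i, j, h, ε * δ, hmul _ ε.2 _ δ.2, rfl⟩, rfl⟩, δ, hne δ, fun v => ?_⟩
      have := hsq δ δ.2
      simp only [lastFunctional, lastSub_apply, initMap_apply, LinearMap.comp_apply,
        LinearMap.sub_apply, LinearMap.smul_apply, proj_apply, smul_eq_mul]
      linear_combination ((ε : ℝ) * v i.castSucc) * this
    · have hεδ : (δ : ℝ) - ε ≠ 0 := by
        intro h0
        refine hab ?_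
        have : δ = ε := Subtype.ext (sub_eq_zero.1 h0)
        rw [this]
      refine ⟨_, ⟨proj i, Or.inl ⟨i, rfl⟩, rfl⟩, _, hεδ, fun v => ?_⟩
      simp [lastFunctional, lastSub_apply, initMap_apply]
      ring
    · refine ⟨_, ⟨_, Or.inr ⟨j, i, h, ε * δ, hmul _ ε.2 _ δ.2, rfl⟩, rfl⟩, -ε,
        neg_ne_zero.2 (hne ε), fun v => ?_⟩
      have := hsq ε ε.2
      simp only [lastFunctional, lastSub_apply, initMap_apply, LinearMap.comp_apply,
        LinearMap.sub_apply, LinearMap.smul_apply, proj_apply, smul_eq_mul]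
      linear_combination (-(δ : ℝ) * v j.castSucc) * this

lemma IsGeneric.exists_lastSub_ne_zero {Sg : Finset ℝ} (h1 : (1 : ℝ) ∈ Sg)
    (hmul : ∀ a ∈ Sg, ∀ b ∈ Sg, a * b ∈ Sg)
    {n : ℕ} {ξ : Fin (n + 2) → E} {U : Submodule ℝ E} (h : IsGeneric Sg ξ U)
    {i : Fin (n + 1)} {ε : ℝ} (hε : ε = 0 ∨ ε ∈ Sg) {v : Fin (n + 2) → ℝ} (hv : v ∈ relSpace ξ U)
    (hv0 : v 0 ≠ 0) : ∃ w ∈ relSpace ξ U, lastSub i ε w ≠ 0 := by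
  by_contra! hcon
  rcases h.absorbLast hmul i hε (n + 1) id (fun _ => 1) (fun _ => Or.inr h1)
    (fun j => ⟨j, rfl, one_ne_zero⟩) with H | H
  · have hl := hcon v hv
    rw [lastSub_apply, sub_eq_zero] at hl
    have := H (fun j => v j.castSucc) (by
      rw [mem_relSpace, Fin.sum_univ_castSucc, hl] at hv
      simpa [sum_absorbLast] using hv)
    exact hv0 (congrFun this 0)
  · obtain ⟨y, hy⟩ := H (-ξ (Fin.last _))
    -- When the absorbed vectors span, $-\xi_n$ is solved for. The resulting relation has
    -- $x_n-\varepsilon x_i=1$.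
    have := hcon (Fin.snoc y (1 + ε * y i)) (by
      rw [mem_relSpace, Fin.sum_univ_castSucc]
      simp only [one_mul, id_eq, sum_absorbLast, sub_neg_eq_add] at hy
      convert hy using 1
      simp only [Fin.snoc_castSucc, Fin.snoc_last, add_smul, one_smul]
      abel)
    simp [lastSub_apply] at this

/-- The number of regions of `arrangement Sg (n + 1)`, `q = |Sg|`, in a generic subspace of
codimension `d`. -/
def regionCount (q : ℕ) : ℕ → ℕ → ℕ
  | 0, 0 => 2
  | 0, _ + 1 => 0
  -- At `d = 0` the truncated `d - 1` is again 0, as it should be: a subspace of codimension 0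
  -- projects onto the whole space. That column counts all chambers.
  | n + 1, d => regionCount q n (d - 1) + (1 + q * (n + 1)) * regionCount q n d

lemma ncard_regions_empty {V : Type*} [AddCommGroup V] [Module ℝ V] (W : Submodule ℝ V) :
    (regions ∅ W).ncard = 1 := by
  have : regions ∅ W = {∅} := by
    ext p
    simp only [regions, Set.mem_image, Set.mem_singleton_iff]
    constructor
    · rintro ⟨v, -, rfl⟩
      ext f; simp [signPattern]
    · rintro rfl
      exact ⟨0, ⟨W.zero_mem, by simp⟩, by ext f; simp [signPattern]⟩
  simp [this]

lemma arrangement_one (Sg : Finset ℝ) : arrangement Sg 1 = insert (proj 0) ∅ := by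
  ext f
  constructor
  · rintro (⟨j, rfl⟩ | ⟨i, j, hij, -⟩)
    · rw [Subsingleton.elim j 0]; simp
    · rw [Subsingleton.elim i j] at hij; exact absurd hij (lt_irrefl _)
  · intro h
    exact Or.inl ⟨0, by simpa using h⟩

/-- Induction on the number of coordinates. Removing the $1+q(n+1)$ hyperplanes through the last
coordinate leaves an arrangement that factors through `initMap`, on a projected relation space of
codimension `d - 1`. Restricting to any one of them gives the smaller arrangement in codimension
`d`. Both spaces are again generic. -/
theorem ncard_regions_arrangement [FiniteDimensional ℝ E] {Sg : Finset ℝ} (h1 : (1 : ℝ) ∈ Sg)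
    (hmul : ∀ a ∈ Sg, ∀ b ∈ Sg, a * b ∈ Sg) (hsq : ∀ a ∈ Sg, a * a = 1) (n : ℕ) :
    ∀ (d : ℕ) (ξ : Fin (n + 1) → E) (U : Submodule ℝ E), Module.finrank ℝ (E ⧸ U) = d →
      IsGeneric Sg ξ U →
      (regions (arrangement Sg (n + 1)) (relSpace ξ U)).ncard = regionCount Sg.card n d := by
  induction n with
  | zero =>
    intro d ξ U hU hξ
    have hone : arrangement Sg (0 + 1) = insert (proj 0) ∅ := arrangement_one Sg
    rw [hone]
    rcases d with _ | d
    · have hU' : U = ⊤ := by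
        rw [Module.finrank_zero_iff, Submodule.Quotient.subsingleton_iff] at hU
        exact hU
      rw [ncard_regions_insert Set.finite_empty, ncard_regions_empty, ncard_regions_empty,
        regionCount]
      intro _
      exact ⟨fun _ => 1, by simp [mem_relSpace, hU'], by simp⟩
    · have hU' : U ≠ ⊤ := by
        rintro rfl
        have : Module.finrank ℝ (E ⧸ (⊤ : Submodule ℝ E)) = 0 := Module.finrank_zero_of_subsingleton
        omega
      have hmem := hξ.last_notMem h1 hU'
      rw [regionCount, Set.ncard_eq_zero (regions_finite (by simp) _), regions,
        Set.image_eq_empty, Set.eq_empty_iff_forall_notMem]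
      rintro v ⟨hv, hv0⟩
      have hv0 : v 0 ≠ 0 := hv0 (proj 0) (by simp)
      rw [mem_relSpace, Fin.sum_univ_castSucc] at hv
      refine hmem ?_
      have : v 0 • ξ (Fin.last 0) ∈ U := by simpa using hv
      exact (Submodule.smul_mem_iff _ hv0).1 this
  | succ n ih =>
    intro d ξ U hU hξ
    rw [arrangement_succ, ncard_regions_union_range ((arrangement_finite Sg _).image _) _ _ ?_
      (lastFunctional_sub hmul hsq n), ncard_regions_comp, map_relSpace,
      ih (d - 1) _ _ ?_ (hξ.sup_last h1), regionCount]
    · congr 1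
      have : ∀ b, (regions ((fun f => f ∘ₗ initMap (n + 1)) '' arrangement Sg (n + 1))
          (relSpace ξ U ⊓ ker (lastFunctional Sg n b))).ncard = regionCount Sg.card n d := by
        rintro (_ | ⟨i, ε⟩)
        · rw [ncard_regions_comp, lastFunctional, map_relSpace_inf_ker,
            ih d _ U hU (hξ.absorbLast hmul 0 (Or.inl rfl))]
        · rw [ncard_regions_comp, lastFunctional, map_relSpace_inf_ker,
            ih d _ U hU (hξ.absorbLast hmul i (Or.inr ε.2))]
      simp only [this]
      simp [mul_comm, add_comm]
    · rcases d with _ | d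
      · have hU' : U = ⊤ := by
          rw [Module.finrank_zero_iff, Submodule.Quotient.subsingleton_iff] at hU
          exact hU
        rw [hU', top_sup_eq]
        exact Module.finrank_zero_of_subsingleton
      · have hU' : U ≠ ⊤ := by
          rintro rfl
          have : Module.finrank ℝ (E ⧸ (⊤ : Submodule ℝ E)) = 0 :=
            Module.finrank_zero_of_subsingleton
          omega
        have hmem := hξ.last_notMem h1 hU'
        have e1 := Submodule.finrank_quotient_add_finrank U
        have e2 := Submodule.finrank_quotient_add_finrank
          (U ⊔ Submodule.span ℝ {ξ (Fin.last (n + 1))})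
        have e3 := Submodule.finrank_sup_add_finrank_inf_eq U
          (Submodule.span ℝ {ξ (Fin.last (n + 1))})
        have e4 : U ⊓ Submodule.span ℝ {ξ (Fin.last (n + 1))} = ⊥ := by
          rw [eq_bot_iff]
          rintro x ⟨hx, hx'⟩
          obtain ⟨t, rfl⟩ := Submodule.mem_span_singleton.1 hx'
          by_cases ht : t = 0
          · simp [ht]
          · exact absurd ((Submodule.smul_mem_iff _ ht).1 hx) hmem
        have e5 : Module.finrank ℝ (Submodule.span ℝ {ξ (Fin.last (n + 1))}) = 1 :=
          finrank_span_singleton fun h0 => hmem (h0 ▸ U.zero_mem)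
        rw [e4, finrank_bot, e5] at e3
        omega
    · rintro ⟨v, hv, hv'⟩ b
      have hv0 : v 0 ≠ 0 := hv' _ ⟨proj 0, Or.inl ⟨0, rfl⟩, rfl⟩
      rcases b with _ | ⟨i, ε⟩
      · exact hξ.exists_lastSub_ne_zero h1 hmul (Or.inl rfl) hv hv0
      · exact hξ.exists_lastSub_ne_zero h1 hmul (Or.inr ε.2) hv hv0

end Arrangement

/-! ### Weyl chambers meeting a subspace correspond to regions. -/

section Chambers

open LinearMap

lemma ncard_setOf_exists_rel {X α G : Type*} {S : Set X} {pat : X → α} {Ch : G → X → Prop}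
    (hex : ∀ x ∈ S, ∃ g, Ch g x)
    (hiff : ∀ x ∈ S, ∀ y ∈ S, ∀ g g', Ch g x → Ch g' y → (g = g' ↔ pat x = pat y)) :
    {g | ∃ x ∈ S, Ch g x}.ncard = (pat '' S).ncard := by
  classical
  rcases S.eq_empty_or_nonempty with rfl | ⟨x₀, hx₀⟩
  · simp
  obtain ⟨g₀, -⟩ := hex x₀ hx₀
  set label : X → G := fun x => if hx : ∃ g, Ch g x then hx.choose else g₀ with hlabel
  have hl : ∀ x ∈ S, Ch (label x) x := by
    intro x hx
    have := hex x hx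
    simp only [hlabel, this, dite_true]
    exact this.choose_spec
  have : {g | ∃ x ∈ S, Ch g x} = label '' S := by
    ext g
    constructor
    · rintro ⟨x, hx, hg⟩
      exact ⟨x, hx, (hiff x hx x hx _ _ (hl x hx) hg).2 rfl⟩
    · rintro ⟨x, hx, rfl⟩
      exact ⟨x, hx, hl x hx⟩
  rw [this]
  exact ncard_image_eq_of_eq_iff fun x hx y hy => hiff x hx y hy _ _ (hl x hx) (hl y hy)

lemma perm_eq_of_strictAnti {n : ℕ} {f : Fin n → ℝ} {σ τ : Equiv.Perm (Fin n)}
    (hσ : StrictAnti fun i => f (σ i)) (hτ : StrictAnti fun i => f (τ i)) : σ = τ := by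
  have h : (fun i => -f (σ i)) = fun i => -f (τ i) := by
    have hs : StrictMono fun i => -f (σ i) := fun i j hij => neg_lt_neg (hσ hij)
    have ht : StrictMono fun i => -f (τ i) := fun i j hij => neg_lt_neg (hτ hij)
    refine (hs.range_inj ht).1 ?_
    have h1 := σ.surjective.range_comp fun i => -f i
    have h2 := τ.surjective.range_comp fun i => -f i
    simp only [Function.comp_def] at h1 h2
    rw [h1, h2]
  have hinj : Function.Injective f := by
    intro a b hab
    have := hσ.injective (a₁ := σ.symm a) (a₂ := σ.symm b) (by simpa using hab)
    simpa using this
  ext i : 1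
  exact hinj (neg_injective (congrFun h i))

lemma exists_perm_strictAnti {n : ℕ} {f : Fin n → ℝ} (hf : Function.Injective f) :
    ∃ σ : Equiv.Perm (Fin n), StrictAnti fun i => f (σ i) := by
  refine ⟨Tuple.sort fun i => -f i, ?_⟩
  have hm := Tuple.monotone_sort fun i => -f i
  refine Antitone.strictAnti_of_injective (fun i j hij => ?_) (hf.comp (Equiv.injective _))
  have := hm hij
  simpa using this

/-- The open chamber of type `B_n` labelled by the signed permutation `g`. -/
def SignedChamber {n : ℕ} (g : Equiv.Perm (Fin n) × (Fin n → ℤˣ)) (x : Fin n → ℝ) : Prop :=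
  StrictAnti (fun i => (((g.2 i : ℤˣ) : ℤ) : ℝ) * x (g.1 i)) ∧
    ∀ i, 0 < (((g.2 i : ℤˣ) : ℤ) : ℝ) * x (g.1 i)

lemma abs_unit_mul (u : ℤˣ) (t : ℝ) : |((u : ℤ) : ℝ) * t| = |t| := by
  rcases Int.units_eq_one_or u with rfl | rfl <;> simp

lemma SignedChamber.strictAnti_abs {n : ℕ} {g : Equiv.Perm (Fin n) × (Fin n → ℤˣ)}
    {x : Fin n → ℝ} (h : SignedChamber g x) : StrictAnti fun i => |x (g.1 i)| := by
  have : (fun i => |x (g.1 i)|) = fun i => (((g.2 i : ℤˣ) : ℤ) : ℝ) * x (g.1 i) := by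
    ext i
    rw [← abs_unit_mul (g.2 i), abs_of_pos (h.2 i)]
  rw [this]
  exact h.1

lemma SignedChamber.ext_of_signs {n : ℕ} {g g' : Equiv.Perm (Fin n) × (Fin n → ℤˣ)}
    {x y : Fin n → ℝ} (h : SignedChamber g x) (h' : SignedChamber g' y)
    (hperm : g.1 = g'.1) (hsgn : ∀ i, 0 < x i ↔ 0 < y i) : g = g' := by
  refine Prod.ext hperm (funext fun i => ?_)
  have h1 := h.2 i
  have h2 := h'.2 i
  have h3 := hsgn (g.1 i)
  rw [← hperm] at h2
  rcases Int.units_eq_one_or (g.2 i) with e | e <;>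
    rcases Int.units_eq_one_or (g'.2 i) with e' | e' <;> simp [e, e'] at h1 h2 ⊢
  · linarith [h3.1 h1]
  · linarith [h3.2 h2]

/-- The signs `{1, -1}`. -/
noncomputable def signs : Finset ℝ := {1, -1}

lemma mem_signs {ε : ℝ} : ε ∈ signs ↔ ε = 1 ∨ ε = -1 := by simp [signs]

lemma SignedChamber.same_sign {n : ℕ} {g : Equiv.Perm (Fin n) × (Fin n → ℤˣ)}
    {x y : Fin n → ℝ} (h : SignedChamber g x) (h' : SignedChamber g y)
    {f : (Fin n → ℝ) →ₗ[ℝ] ℝ} (hf : f ∈ arrangement signs n) (hfx : 0 < f x) : 0 < f y := by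
  have hs : ∀ i, (0 < x i ∧ 0 < y i) ∨ (x i < 0 ∧ y i < 0) := by
    intro i
    have h1 := h.2 (g.1.symm i)
    have h2 := h'.2 (g.1.symm i)
    rcases Int.units_eq_one_or (g.2 (g.1.symm i)) with e | e <;> simp [e] at h1 h2
    · exact Or.inl ⟨h1, h2⟩
    · exact Or.inr ⟨h1, h2⟩
  rcases hf with ⟨j, rfl⟩ | ⟨i, j, hij, ε, hε, rfl⟩
  · rcases hs j with h0 | h0
    · exact h0.2
    · exact absurd hfx (not_lt.2 h0.1.le)
  · have ha := h.strictAnti_abs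
    have ha' := h'.strictAnti_abs
    have hord : (|x i| < |x j| ∧ |y i| < |y j|) ∨ (|x j| < |x i| ∧ |y j| < |y i|) := by
      obtain ⟨a, rfl⟩ := g.1.surjective i
      obtain ⟨b, rfl⟩ := g.1.surjective j
      rcases lt_trichotomy a b with hab | rfl | hab
      · exact Or.inr ⟨ha hab, ha' hab⟩
      · exact absurd hij (lt_irrefl _)
      · exact Or.inl ⟨ha hab, ha' hab⟩
    simp only [LinearMap.sub_apply, proj_apply, LinearMap.smul_apply, smul_eq_mul] at hfx ⊢
    rcases mem_signs.1 hε with rfl | rfl <;> rcases hs i with hi | hi <;>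
      rcases hs j with hj | hj <;>
      simp only [abs_of_pos, abs_of_neg, hi.1, hi.2, hj.1, hj.2] at hord <;>
      rcases hord with hord | hord <;> linarith [hord.1, hord.2]

/-- The signs of the factors decide the sign of $a^2-b^2=(a-b)(a+b)$. The conclusion is weak because
$c\pm e$ may vanish; strictness is recovered later from injectivity. -/
lemma abs_lt_abs_iff_of_signs {a b c e : ℝ} (hab : a - b ≠ 0) (hab' : a + b ≠ 0)
    (h1 : 0 < a - b ↔ 0 < c - e) (h2 : 0 < a + b ↔ 0 < c + e) (h : |b| < |a|) :
    |e| ≤ |c| := by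
  rw [← sq_lt_sq] at h
  rw [← sq_le_sq]
  rcases lt_or_gt_of_ne hab with h3 | h3
  · have h5 : a + b < 0 := by
      rcases lt_or_gt_of_ne hab' with h4 | h4
      · exact h4
      · nlinarith
    have : c - e ≤ 0 := not_lt.1 fun h' => by linarith [h1.2 h']
    have : c + e ≤ 0 := not_lt.1 fun h' => by linarith [h2.2 h']
    nlinarith
  · have h5 : 0 < a + b := by
      rcases lt_or_gt_of_ne hab' with h4 | h4
      · nlinarith
      · exact h4
    have := h1.1 h3
    have := h2.1 h5
    nlinarith

lemma abs_injective_of_mem_genericPoints {n : ℕ} {W : Submodule ℝ (Fin n → ℝ)}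
    {x : Fin n → ℝ} (hx : x ∈ genericPoints (arrangement signs n) W) :
    (∀ i, x i ≠ 0) ∧ (∀ i j, i < j → x j - x i ≠ 0 ∧ x j + x i ≠ 0) ∧
      Function.Injective fun i => |x i| := by
  have h0 : ∀ i, x i ≠ 0 := fun i => hx.2 _ (Or.inl ⟨i, rfl⟩)
  have h1 : ∀ i j, i < j → x j - x i ≠ 0 ∧ x j + x i ≠ 0 := by
    intro i j hij
    have e1 := hx.2 _ (Or.inr ⟨i, j, hij, 1, by simp [signs], rfl⟩)
    have e2 := hx.2 _ (Or.inr ⟨i, j, hij, -1, by simp [signs], rfl⟩)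
    simp only [LinearMap.sub_apply, proj_apply, LinearMap.smul_apply, smul_eq_mul, one_mul, neg_mul,
      sub_neg_eq_add] at e1 e2
    exact ⟨e1, e2⟩
  refine ⟨h0, h1, ?_⟩
  have key : ∀ i j, i < j → |x i| ≠ |x j| := by
    intro i j hij h
    rcases abs_eq_abs.1 h with h | h
    · exact (h1 i j hij).1 (by linarith)
    · exact (h1 i j hij).2 (by linarith)
  intro i j hij
  rcases lt_trichotomy i j with h | h | h
  · exact absurd hij (key i j h)
  · exact h
  · exact absurd hij.symm (key j i h)

/-- Signed permutations whose open chamber meets `W` correspond to the regions of `W`. -/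
theorem ncard_signedChamber {n : ℕ} (W : Submodule ℝ (Fin n → ℝ)) :
    {g | ∃ x ∈ W, SignedChamber g x}.ncard = (regions (arrangement signs n) W).ncard := by
  have hgen : ∀ g x, SignedChamber g x → ∀ f ∈ arrangement signs n, f x ≠ 0 := by
    intro g x h
    have h0 : ∀ i, x i ≠ 0 := by
      intro i hi
      have := h.2 (g.1.symm i)
      simp [hi] at this
    have ha := h.strictAnti_abs
    rintro f (⟨j, rfl⟩ | ⟨i, j, hij, ε, hε, rfl⟩)
    · exact h0 j
    · intro hf
      simp only [LinearMap.sub_apply, proj_apply, LinearMap.smul_apply, smul_eq_mul] at hf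
      have : |x i| = |x j| := by
        rw [sub_eq_zero.1 hf, abs_mul]
        rcases mem_signs.1 hε with rfl | rfl <;> simp
      have := ha.injective (a₁ := g.1.symm i) (a₂ := g.1.symm j) (by simpa using this)
      exact hij.ne (g.1.symm.injective this)
  have hset : {g | ∃ x ∈ W, SignedChamber g x} =
      {g | ∃ x ∈ genericPoints (arrangement signs n) W, SignedChamber g x} := by
    ext g
    constructor
    · rintro ⟨x, hx, h⟩; exact ⟨x, ⟨hx, hgen g x h⟩, h⟩
    · rintro ⟨x, hx, h⟩; exact ⟨x, hx.1, h⟩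
  rw [hset, regions]
  refine ncard_setOf_exists_rel ?_ ?_
  · intro x hx
    obtain ⟨h0, -, hinj⟩ := abs_injective_of_mem_genericPoints hx
    obtain ⟨σ, hσ⟩ := exists_perm_strictAnti hinj
    have habs : ∀ i, (((if 0 < x (σ i) then (1 : ℤˣ) else -1 : ℤˣ) : ℤ) : ℝ) * x (σ i) =
        |x (σ i)| := by
      intro i
      split_ifs with h
      · simp [abs_of_pos h]
      · simp [abs_of_nonpos (not_lt.1 h)]
    refine ⟨(σ, fun i => if 0 < x (σ i) then 1 else -1), ?_, ?_⟩
    · simp only [habs]; exact hσ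
    · intro i
      simp only [habs]
      exact abs_pos.2 (h0 _)
  · intro x hx y hy g g' h h'
    constructor
    · rintro rfl
      exact signPattern_eq_iff.2 fun f hf => ⟨h.same_sign h' hf, h'.same_sign h hf⟩
    · intro hp
      rw [signPattern_eq_iff] at hp
      obtain ⟨-, hxp, hxi⟩ := abs_injective_of_mem_genericPoints hx
      obtain ⟨-, -, hyi⟩ := abs_injective_of_mem_genericPoints hy
      refine h.ext_of_signs h' ?_ fun i => hp _ (Or.inl ⟨i, rfl⟩)
      -- The sorting permutation of $|y|$ is unique, so it suffices that the one sorting $|x|$ also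
      -- sorts $|y|$.
      refine perm_eq_of_strictAnti (f := fun i => |y i|) ?_ h'.strictAnti_abs
      have ha := h.strictAnti_abs
      refine Antitone.strictAnti_of_injective ?_ (hyi.comp g.1.injective)
      have key : ∀ i j, i < j → (0 < x j - x i ↔ 0 < y j - y i) ∧
          (0 < x j + x i ↔ 0 < y j + y i) := by
        intro i j hij
        have e1 := hp _ (Or.inr ⟨i, j, hij, 1, by simp [signs], rfl⟩)
        have e2 := hp _ (Or.inr ⟨i, j, hij, -1, by simp [signs], rfl⟩)
        simp only [LinearMap.sub_apply, proj_apply, LinearMap.smul_apply, smul_eq_mul, one_mul, neg_mul,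
          sub_neg_eq_add] at e1 e2
        exact ⟨e1, e2⟩
      intro a b hab
      rcases hab.eq_or_lt with rfl | hab
      · exact le_rfl
      have hlt := ha hab
      simp only at hlt ⊢
      rcases lt_or_gt_of_ne (g.1.injective.ne hab.ne) with hij | hij
      · obtain ⟨k1, k2⟩ := key _ _ hij
        obtain ⟨n1, n2⟩ := hxp _ _ hij
        have hyn : y (g.1 b) - y (g.1 a) ≠ 0 := by
          have := hy.2 _ (Or.inr ⟨_, _, hij, 1, by simp [signs], rfl⟩)
          simpa using this
        refine abs_lt_abs_iff_of_signs (a := x (g.1 a)) (b := x (g.1 b))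
          (sub_ne_zero.2 (sub_ne_zero.1 n1).symm) (by rwa [add_comm]) ?_
          (by rw [add_comm (x _), k2, add_comm (y _)]) hlt
        constructor
        · intro h1
          have : ¬ 0 < y (g.1 b) - y (g.1 a) := fun h2 => by linarith [k1.2 h2]
          have := lt_of_le_of_ne (not_lt.1 this) hyn
          linarith
        · intro h1
          have : ¬ 0 < x (g.1 b) - x (g.1 a) := fun h2 => by linarith [k1.1 h2]
          have := lt_of_le_of_ne (not_lt.1 this) n1
          linarith
      · obtain ⟨k1, k2⟩ := key _ _ hij
        obtain ⟨n1, n2⟩ := hxp _ _ hij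
        exact abs_lt_abs_iff_of_signs n1 n2 k1 k2 hlt

lemma exists_sub_of_mem_arrangement {n : ℕ} {f : (Fin n → ℝ) →ₗ[ℝ] ℝ}
    (hf : f ∈ arrangement {1} n) : ∃ a b : Fin (n + 1), a ≠ b ∧ ∀ x : Fin n → ℝ,
      f x = (Fin.snoc x 0 : Fin (n + 1) → ℝ) a - (Fin.snoc x 0 : Fin (n + 1) → ℝ) b := by
  rcases hf with ⟨j, rfl⟩ | ⟨i, j, hij, ε, hε, rfl⟩
  · exact ⟨j.castSucc, Fin.last n, (Fin.castSucc_lt_last j).ne, fun x => by simp⟩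
  · rw [Finset.mem_singleton] at hε
    exact ⟨j.castSucc, i.castSucc, by simpa using hij.ne', fun x => by simp [hε]⟩

lemma exists_mem_arrangement_of_lt {n : ℕ} {a b : Fin (n + 1)} (hab : a < b) :
    ∃ f ∈ arrangement {1} n, (∀ x : Fin n → ℝ,
      f x = (Fin.snoc x 0 : Fin (n + 1) → ℝ) a - (Fin.snoc x 0 : Fin (n + 1) → ℝ) b) ∨
      (∀ x : Fin n → ℝ,
      f x = (Fin.snoc x 0 : Fin (n + 1) → ℝ) b - (Fin.snoc x 0 : Fin (n + 1) → ℝ) a) := by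
  obtain ⟨i, rfl⟩ := Fin.exists_castSucc_eq.2 (hab.trans_le (Fin.le_last b)).ne
  revert hab
  refine Fin.lastCases (fun _ => ?_) (fun j hab => ?_) b
  · exact ⟨_, Or.inl ⟨i, rfl⟩, Or.inl fun x => by simp⟩
  · exact ⟨_, Or.inr ⟨i, j, by simpa using hab, 1, by simp, rfl⟩, Or.inr fun x => by simp⟩

lemma exists_mem_arrangement_of_ne {n : ℕ} {a b : Fin (n + 1)} (hab : a ≠ b) :
    ∃ f ∈ arrangement {1} n, (∀ x : Fin n → ℝ,
      f x = (Fin.snoc x 0 : Fin (n + 1) → ℝ) a - (Fin.snoc x 0 : Fin (n + 1) → ℝ) b) ∨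
      (∀ x : Fin n → ℝ,
      f x = (Fin.snoc x 0 : Fin (n + 1) → ℝ) b - (Fin.snoc x 0 : Fin (n + 1) → ℝ) a) := by
  rcases lt_or_gt_of_ne hab with h | h
  · exact exists_mem_arrangement_of_lt h
  · obtain ⟨f, hf, h'⟩ := exists_mem_arrangement_of_lt h
    exact ⟨f, hf, h'.symm⟩

lemma snoc_injective_of_mem_genericPoints {n : ℕ} {W : Submodule ℝ (Fin n → ℝ)} {x : Fin n → ℝ}
    (hx : x ∈ genericPoints (arrangement {1} n) W) :
    Function.Injective (Fin.snoc x 0 : Fin (n + 1) → ℝ) := by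
  intro a b hab
  by_contra hne
  obtain ⟨f, hf, h | h⟩ := exists_mem_arrangement_of_ne hne <;>
    exact hx.2 f hf (by rw [h, hab, sub_self])

/-- Permutations whose open chamber meets `W × {0}` correspond to the regions of `W`. -/
theorem ncard_permChamber {n : ℕ} (W : Submodule ℝ (Fin n → ℝ)) :
    {σ : Equiv.Perm (Fin (n + 1)) | ∃ x ∈ W, StrictAnti fun i =>
      (Fin.snoc x 0 : Fin (n + 1) → ℝ) (σ i)}.ncard = (regions (arrangement {1} n) W).ncard := by
  have hset : {σ : Equiv.Perm (Fin (n + 1)) | ∃ x ∈ W, StrictAnti fun i =>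
        (Fin.snoc x 0 : Fin (n + 1) → ℝ) (σ i)} =
      {σ : Equiv.Perm (Fin (n + 1)) | ∃ x ∈ genericPoints (arrangement {1} n) W,
        StrictAnti fun i => (Fin.snoc x 0 : Fin (n + 1) → ℝ) (σ i)} := by
    ext σ
    constructor
    · rintro ⟨x, hx, h⟩
      refine ⟨x, ⟨hx, fun f hf h0 => ?_⟩, h⟩
      obtain ⟨a, b, hab, hfab⟩ := exists_sub_of_mem_arrangement hf
      rw [hfab, sub_eq_zero] at h0
      exact hab (σ.symm.injective (h.injective (by simpa using h0)))
    · rintro ⟨x, hx, h⟩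
      exact ⟨x, hx.1, h⟩
  rw [hset, regions]
  refine ncard_setOf_exists_rel
    (fun x hx => exists_perm_strictAnti (snoc_injective_of_mem_genericPoints hx)) ?_
  intro x hx y hy σ τ hσ hτ
  constructor
  · rintro rfl
    refine signPattern_eq_iff.2 fun f hf => ?_
    obtain ⟨a, b, -, hfab⟩ := exists_sub_of_mem_arrangement hf
    rw [hfab, hfab, sub_pos, sub_pos]
    obtain ⟨a, rfl⟩ := σ.surjective a
    obtain ⟨b, rfl⟩ := σ.surjective b
    rw [hσ.lt_iff_gt, hτ.lt_iff_gt]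
  · intro hp
    rw [signPattern_eq_iff] at hp
    refine perm_eq_of_strictAnti (f := (Fin.snoc y 0 : Fin (n + 1) → ℝ)) ?_ hτ
    intro a b hab
    have hlt := hσ hab
    obtain ⟨f, hf, h⟩ := exists_mem_arrangement_of_ne (σ.injective.ne hab.ne)
    have hpf := hp f hf
    have hyf := hy.2 f hf
    rcases h with h | h
    · rw [h, h, sub_pos, sub_pos] at hpf
      exact hpf.1 hlt
    · rw [h, h, sub_pos, sub_pos] at hpf
      rw [h, sub_ne_zero] at hyf
      exact lt_of_le_of_ne (not_lt.1 fun h' => hlt.not_gt (hpf.2 h')) hyf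

end Chambers

/-! ### General position of partial sums implies genericity of the relation space. -/

section GeneralPosition

open Finset

variable {E : Type*} [AddCommGroup E] [Module ℝ E]

/-- The partial sum of the first `k` vectors of a configuration. -/
def stepSum {n : ℕ} (v : Fin n → E) (k : ℕ) : E :=
  ∑ i ∈ univ.filter (fun i : Fin n => (i : ℕ) < k), v i

/-- The action of a signed permutation on a configuration. -/
def signedAct {n : ℕ} (g : Equiv.Perm (Fin n) × (Fin n → ℤˣ)) (v : Fin n → E) : Fin n → E :=
  fun i => g.2 i • v (g.1 i)

/-- Any `d` among the partial sums `S_1, …, S_K` are linearly independent. -/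
def SumsGeneric {n : ℕ} (v : Fin n → E) (K d : ℕ) : Prop :=
  ∀ s : Fin d → ℕ, Function.Injective s → (∀ j, s j ∈ Set.Icc 1 K) →
    LinearIndependent ℝ fun j => stepSum v (s j)

lemma SumsGeneric.linearIndepOn {n : ℕ} {v : Fin n → E} {K d : ℕ} (h : SumsGeneric v K d)
    (hdK : d ≤ K) {t : Finset ℕ} (ht : t ⊆ Icc 1 K) (htd : t.card ≤ d) :
    LinearIndepOn ℝ (stepSum v) (t : Set ℕ) := by
  obtain ⟨t', htt', ht', hcard⟩ := Finset.exists_subsuperset_card_eq ht htd (by simpa using hdK)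
  have hli := h (t'.orderEmbOfFin hcard) (t'.orderEmbOfFin hcard).injective (fun j => by
    have := ht' (t'.orderEmbOfFin_mem hcard j)
    simpa using this)
  have hli' : LinearIndepOn ℝ (stepSum v) (t' : Set ℕ) := by
    have := hli.comp (t'.orderIsoOfFin hcard).symm (t'.orderIsoOfFin hcard).symm.injective
    have e : ((fun j => stepSum v (t'.orderEmbOfFin hcard j)) ∘ (t'.orderIsoOfFin hcard).symm) =
        fun x : t' => stepSum v x := by
      funext x
      simp [← Finset.coe_orderIsoOfFin_apply]
    rw [e] at this
    exact this
  exact hli'.mono (by exact_mod_cast htt')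

lemma tail_sum_telescope (Y : ℕ → ℝ) {j K : ℕ} (hjK : j ≤ K) :
    ∑ k ∈ range K, (if j ≤ k then Y k - Y (k + 1) else 0) = Y j - Y K := by
  induction K, hjK using Nat.le_induction with
  | base =>
    rw [sub_self]
    exact sum_eq_zero fun k hk => if_neg (by simpa using hk)
  | succ K hK ih => rw [sum_range_succ, ih, if_pos hK]; ring

/-- Every tuple is obtained by summing the tails of another one. -/
lemma exists_tail_sum {r : ℕ} (y : Fin r → ℝ) :
    ∃ a : Fin r → ℝ, ∀ j, y j = ∑ k, if j ≤ k then a k else 0 := by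
  -- The default value 0 at `r` makes the telescoping sum end at `y j`.
  set Y : ℕ → ℝ := fun k => if h : k < r then y ⟨k, h⟩ else 0
  refine ⟨fun k => Y k - Y (k + 1), fun j => ?_⟩
  have := tail_sum_telescope Y j.2.le
  rw [← Fin.sum_univ_eq_sum_range (fun k => if (j : ℕ) ≤ k then Y k - Y (k + 1) else 0)] at this
  simp only [Fin.val_fin_le] at this
  rw [this]
  simp [Y]

/-- Summing the blocks of a signed ordered partition: independence or spanning is inherited from
the partial sums of a suitable rearrangement. -/
lemma blocks_injective_or_spanning [FiniteDimensional ℝ E] {n K d r : ℕ} {v : Fin n → E}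
    (hd : Module.finrank ℝ E = d) (hdK : d ≤ K) (c : Fin n → Fin r) (s : Fin n → ℝ)
    (hs : ∀ i, s i = 0 ∨ s i = 1 ∨ s i = -1) (hc : ∀ j, ∃ i, c i = j ∧ s i ≠ 0)
    (hK : (univ.filter fun i => s i ≠ 0).card ≤ K)
    (H : ∀ σ : Equiv.Perm (Fin n),
      SumsGeneric (signedAct (σ, fun i => if s (σ i) = -1 then -1 else 1) v) K d) :
    (∀ y : Fin r → ℝ, ∑ i, (s i * y (c i)) • v i = 0 → y = 0) ∨
      ∀ e : E, ∃ y : Fin r → ℝ, ∑ i, (s i * y (c i)) • v i = e := by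
  classical
  -- Sorting by `key` lists the blocks in order and the erased indices last. The sum `T j` of the
  -- blocks up to `j` is then the partial sum of index `m j` of the rearranged walk `w`. Writing `y`
  -- as tail sums of `a` turns the block combination into $\sum_k a_kT_k$, so independence or
  -- spanning depends only on whether `r ≤ d` or `d ≤ r`.
  set key : Fin n → ℕ := fun i => if s i = 0 then r else c i with hkey
  set σ := Tuple.sort key with hσ
  have hmono : Monotone fun i => key (σ i) := Tuple.monotone_sort key
  set w := signedAct (σ, fun i => if s (σ i) = -1 then -1 else 1) v with hw
  have Hσ : SumsGeneric w K d := H σ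
  set m : Fin r → ℕ := fun j => (univ.filter fun i => key (σ i) ≤ (j : ℕ)).card with hm
  set T : Fin r → E := fun j => ∑ i, (if c i ≤ j then s i else 0) • v i with hT
  have hkey_le : ∀ i (j : Fin r), key i ≤ (j : ℕ) ↔ s i ≠ 0 ∧ c i ≤ j := by
    intro i j
    simp only [hkey]
    split_ifs with h
    · exact iff_of_false (not_le.2 j.2) fun h' => h'.1 h
    · exact ⟨fun h' => ⟨h, h'⟩, fun h' => h'.2⟩
  have hcard : ∀ j : Fin r, m j = (univ.filter fun i => key i ≤ (j : ℕ)).card := by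
    intro j
    refine Finset.card_bij (fun i _ => σ i) ?_ (fun a _ b _ h => σ.injective h) ?_
    · intro i hi; simpa using hi
    · intro i hi
      have hi' := (mem_filter.1 hi).2
      exact ⟨σ.symm i, by simpa using hi', σ.apply_symm_apply i⟩
  have hTm : ∀ j, T j = stepSum w (m j) := by
    intro j
    have h1 : stepSum w (m j) = ∑ i, if key (σ i) ≤ (j : ℕ) then w i else 0 := by
      rw [stepSum, sum_filter]
      refine sum_congr rfl fun i _ => ?_
      simp only [hm, Tuple.lt_card_le_iff_apply_le_of_monotone hmono]
    rw [h1]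
    refine (Equiv.sum_comp σ fun i => (if c i ≤ j then s i else 0) • v i).symm.trans ?_
    refine sum_congr rfl fun i _ => ?_
    simp only [hkey_le, hw, signedAct]
    rcases hs (σ i) with h | h | h <;> by_cases hcj : c (σ i) ≤ j <;> simp [h, hcj]; norm_num
  have hmlt : StrictMono m := by
    intro j j' hjj'
    rw [hcard, hcard]
    refine Finset.card_lt_card ((Finset.ssubset_iff_of_subset ?_).2 ?_)
    · intro i hi
      have : key i ≤ j := by simpa using hi
      simpa using this.trans hjj'.le
    · obtain ⟨i, hi, hsi⟩ := hc j'
      refine ⟨i, ?_, ?_⟩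
      · simpa using (hkey_le i j').2 ⟨hsi, hi.le⟩
      · intro hi'
        have := (hkey_le i j).1 (by simpa using hi')
        rw [hi] at this
        exact absurd hjj' (not_lt.2 this.2)
  have hmem : ∀ j, m j ∈ Icc 1 K := by
    intro j
    rw [mem_Icc]
    constructor
    · rw [hcard, Nat.one_le_iff_ne_zero, Finset.card_ne_zero]
      obtain ⟨i, hi, hsi⟩ := hc j
      exact ⟨i, by simpa using (hkey_le i j).2 ⟨hsi, hi.le⟩⟩
    · rw [hcard]
      refine (Finset.card_le_card ?_).trans hK
      intro i hi
      have := (hkey_le i j).1 (by simpa using hi)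
      simpa using this.1
  have hswap : ∀ a : Fin r → ℝ,
      ∑ i, (s i * ∑ k, if c i ≤ k then a k else 0) • v i = ∑ k, a k • T k := by
    intro a
    simp only [hT, smul_sum, mul_sum, sum_smul]
    rw [sum_comm]
    refine sum_congr rfl fun k _ => sum_congr rfl fun i _ => ?_
    split_ifs <;> simp [smul_smul, mul_comm]
  rcases le_total r d with hrd | hrd
  · left
    intro y hy
    obtain ⟨a, ha⟩ := exists_tail_sum y
    simp only [ha, hswap] at hy
    have hli : LinearIndependent ℝ T := by
      have h1 := Hσ.linearIndepOn hdK (t := univ.image m)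
        (by intro k hk; obtain ⟨j, -, rfl⟩ := mem_image.1 hk; exact hmem j)
        (card_image_le.trans (by simpa using hrd))
      have h2 := LinearIndependent.comp h1 (fun j : Fin r => ⟨m j, by simp⟩)
        (fun a b hab => hmlt.injective (by simpa using hab))
      have : T = fun j => stepSum w (m j) := funext hTm
      rw [this]
      exact h2
    have ha0 := Fintype.linearIndependent_iff.1 hli a hy
    ext j
    simp [ha, ha0]
  · right
    have hli : LinearIndependent ℝ fun j : Fin d => stepSum w (m (Fin.castLE hrd j)) :=
      Hσ _ (hmlt.injective.comp (Fin.castLE_injective hrd)) (fun j => by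
        simpa using hmem (Fin.castLE hrd j))
    have hspan := hli.span_eq_top_of_card_eq_finrank' (by simp [hd])
    intro e
    have he : e ∈ Submodule.span ℝ (Set.range T) := by
      refine Submodule.span_mono ?_ (hspan ▸ Submodule.mem_top : e ∈ Submodule.span ℝ
        (Set.range fun j : Fin d => stepSum w (m (Fin.castLE hrd j))))
      rintro _ ⟨j, rfl⟩
      exact ⟨Fin.castLE hrd j, hTm _⟩
    obtain ⟨a, ha⟩ := (Submodule.mem_span_range_iff_exists_fun ℝ).1 he
    exact ⟨fun j => ∑ k, if j ≤ k then a k else 0, by rw [hswap, ha]⟩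

lemma isGeneric_signs [FiniteDimensional ℝ E] {n d : ℕ} {v : Fin n → E}
    (hd : Module.finrank ℝ E = d) (hdn : d ≤ n)
    (H : ∀ g, SumsGeneric (signedAct g v) n d) : IsGeneric signs v ⊥ := by
  intro r c s hs hc
  simp only [Submodule.mem_bot, sub_eq_zero]
  exact blocks_injective_or_spanning hd hdn c s (fun i => (hs i).imp_right mem_signs.1) hc
    ((card_le_univ _).trans (by simp)) fun σ => H _

/-- The last increment is treated as erased, so at most `n` indices remain and only $S_1,\dots,S_n$
are needed; for a bridge the full sum vanishes. -/
lemma isGeneric_one [FiniteDimensional ℝ E] {n d : ℕ} {v : Fin (n + 1) → E}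
    (hd : Module.finrank ℝ E = d) (hdn : d ≤ n)
    (H : ∀ σ : Equiv.Perm (Fin (n + 1)), SumsGeneric (fun i => v (σ i)) n d) :
    IsGeneric {1} (fun i : Fin n => v i.castSucc) ⊥ := by
  intro r c s hs hc
  simp only [Submodule.mem_bot, sub_eq_zero]
  rcases Nat.eq_zero_or_pos r with rfl | hr
  · exact Or.inl fun y _ => Subsingleton.elim _ _
  have hs' : ∀ i, s i = 0 ∨ s i = 1 := fun i => (hs i).imp_right Finset.mem_singleton.1
  have := blocks_injective_or_spanning (v := v) hd hdn
    (Fin.snoc c ⟨0, hr⟩ : Fin (n + 1) → Fin r) (Fin.snoc s 0 : Fin (n + 1) → ℝ) ?_ ?_ ?_ ?_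
  · simpa [Fin.sum_univ_castSucc] using this
  · intro i
    refine Fin.lastCases (by simp) (fun i => ?_) i
    rcases hs' i with h | h <;> simp [h]
  · intro j
    obtain ⟨i, hi⟩ := hc j
    exact ⟨i.castSucc, by simpa using hi⟩
  · have hsub : (univ.filter fun i => (Fin.snoc s 0 : Fin (n + 1) → ℝ) i ≠ 0) ⊆
        univ.erase (Fin.last n) := by
      intro i hi
      rw [mem_erase]
      refine ⟨?_, mem_univ _⟩
      rintro rfl
      simp at hi
    exact (card_le_card hsub).trans (by simp)
  · intro σ
    have hne : ∀ i, ¬ (Fin.snoc s 0 : Fin (n + 1) → ℝ) i = -1 := by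
      intro i
      refine Fin.lastCases (by simp) (fun i => ?_) i
      rcases hs' i with h | h <;> simp [h]; norm_num
    have : signedAct (σ, fun i => if (Fin.snoc s 0 : Fin (n + 1) → ℝ) (σ i) = -1 then -1 else 1) v =
        fun i => v (σ i) := by
      ext i; simp [signedAct, hne]
    rw [this]
    exact H σ

/-! ### From the origin in the hull to decreasing coefficients. -/

lemma mem_convexHull_image_finset {ι : Type*} {f : ι → E} {t : Finset ι} {x : E} :
    x ∈ convexHull ℝ (f '' (t : Set ι)) ↔
      ∃ w : ι → ℝ, (∀ i ∈ t, 0 ≤ w i) ∧ ∑ i ∈ t, w i = 1 ∧ ∑ i ∈ t, w i • f i = x := by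
  classical
  constructor
  · intro hx
    have : convexHull ℝ (f '' (t : Set ι)) ⊆
        {x | ∃ w : ι → ℝ, (∀ i ∈ t, 0 ≤ w i) ∧ ∑ i ∈ t, w i = 1 ∧ ∑ i ∈ t, w i • f i = x} := by
      refine convexHull_min ?_ ?_
      · rintro _ ⟨i, hi, rfl⟩
        have hi : i ∈ t := hi
        refine ⟨Pi.single i 1, fun j _ => ?_, ?_, ?_⟩
        · rw [Pi.single_apply]; split_ifs <;> norm_num
        · simp [Pi.single_apply, hi]
        · simp [Pi.single_apply, hi]
      · rintro _ ⟨w, hw0, hw1, rfl⟩ _ ⟨u, hu0, hu1, rfl⟩ a b ha hb hab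
        refine ⟨fun i => a * w i + b * u i, fun i hi => ?_, ?_, ?_⟩
        · have := hw0 i hi
          have := hu0 i hi
          positivity
        · rw [sum_add_distrib, ← mul_sum, ← mul_sum, hw1, hu1]; simpa using hab
        · simp only [add_smul, sum_add_distrib, smul_sum, mul_smul]
    exact this hx
  · rintro ⟨w, hw0, hw1, rfl⟩
    exact (convex_convexHull ℝ _).sum_mem hw0 hw1
      fun i hi => subset_convexHull ℝ _ ⟨i, hi, rfl⟩

/-- The convex hull of the partial sums `S_1, …, S_K`. -/
def sumsHull {n : ℕ} (v : Fin n → E) (K : ℕ) : Set E :=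
  convexHull ℝ (stepSum v '' Set.Icc 1 K)

lemma mem_sumsHull_iff {n : ℕ} {v : Fin n → E} {K : ℕ} {x : E} : x ∈ sumsHull v K ↔
    ∃ w : ℕ → ℝ, (∀ k ∈ Icc 1 K, 0 ≤ w k) ∧ ∑ k ∈ Icc 1 K, w k = 1 ∧
      ∑ k ∈ Icc 1 K, w k • stepSum v k = x := by
  rw [sumsHull, ← Finset.coe_Icc, mem_convexHull_image_finset]

lemma zero_mem_sumsHull_of_pos {n : ℕ} {v : Fin n → E} {K : ℕ} (hK : 1 ≤ K) {w : ℕ → ℝ}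
    (hw : ∀ k ∈ Icc 1 K, 0 < w k) (h : ∑ k ∈ Icc 1 K, w k • stepSum v k = 0) :
    0 ∈ sumsHull v K := by
  have hpos : 0 < ∑ k ∈ Icc 1 K, w k := sum_pos hw ⟨1, by simpa using hK⟩
  refine mem_sumsHull_iff.2 ⟨fun k => (∑ k ∈ Icc 1 K, w k)⁻¹ * w k, fun k hk => ?_, ?_, ?_⟩
  · have := hw k hk
    positivity
  · rw [← mul_sum, inv_mul_cancel₀ hpos.ne']
  · simp only [mul_smul, ← smul_sum, h, smul_zero]

/-- In general position, if `0` is in the hull then it is a combination of all partial sums with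
positive coefficients. -/
lemma SumsGeneric.exists_pos_combination [FiniteDimensional ℝ E] {n K d : ℕ} {v : Fin n → E}
    (h : SumsGeneric v K d) (hd : Module.finrank ℝ E = d) (hdK : d ≤ K) (h0 : 0 ∈ sumsHull v K) :
    ∃ w : ℕ → ℝ, (∀ k ∈ Icc 1 K, 0 < w k) ∧ ∑ k ∈ Icc 1 K, w k • stepSum v k = 0 := by
  classical
  obtain ⟨w, hw0, hw1, hw⟩ := mem_sumsHull_iff.1 h0
  set T := (Icc 1 K).filter fun k => w k ≠ 0 with hT
  have hTsub : T ⊆ Icc 1 K := filter_subset _ _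
  have hTsum : ∑ k ∈ T, w k • stepSum v k = 0 := by
    rw [← hw]
    refine sum_subset hTsub fun k hk hkT => ?_
    have : w k = 0 := by
      by_contra hne
      exact hkT (mem_filter.2 ⟨hk, hne⟩)
    rw [this, zero_smul]
  -- A support of at most `d` indices would be independent, forcing all weights to vanish.
  have hdT : d < T.card := by
    by_contra hcon
    have hli := linearIndepOn_finset_iff.1 (h.linearIndepOn hdK hTsub (not_lt.1 hcon)) w hTsum
    have : ∑ k ∈ Icc 1 K, w k = 0 := by
      refine sum_eq_zero fun k hk => ?_
      by_contra hne
      exact hne (hli k (mem_filter.2 ⟨hk, hne⟩))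
    linarith
  obtain ⟨t, htT, htd⟩ := exists_subset_card_eq hdT.le
  have hli := h.linearIndepOn hdK (htT.trans hTsub) htd.le
  have hspan := LinearIndependent.span_eq_top_of_card_eq_finrank' hli (by simp [htd, hd])
  have hmem : -∑ k ∈ Icc 1 K, stepSum v k ∈ Submodule.span ℝ
      (Set.range fun k : (t : Set ℕ) => stepSum v k) := hspan ▸ Submodule.mem_top
  obtain ⟨b, hb⟩ := (Submodule.mem_span_range_iff_exists_fun ℝ).1 hmem
  -- Since `t` spans, $\sum_k(1+c_k)S_k=0$ with `c` supported in `t`. Adding a small multiple `δ` of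
  -- this relation keeps the weights positive on `T` and makes them equal to `δ` outside it.
  set c : ℕ → ℝ := fun k => if hk : k ∈ (t : Set ℕ) then b ⟨k, hk⟩ else 0 with hc
  have hcsum : ∑ k ∈ Icc 1 K, c k • stepSum v k = -∑ k ∈ Icc 1 K, stepSum v k := by
    rw [← hb, ← sum_subset (htT.trans hTsub), ← sum_coe_sort t]
    · refine sum_congr rfl fun k _ => ?_
      simp [hc]
    · intro k _ hk
      simp [hc, hk]
  have hev : ∀ᶠ δ : ℝ in nhdsWithin 0 (Set.Ioi 0), ∀ k ∈ Icc 1 K, 0 < w k + δ * (1 + c k) := by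
    rw [Filter.eventually_all_finset]
    intro k hk
    by_cases hkT : k ∈ T
    · have hwk : 0 < w k := lt_of_le_of_ne (hw0 k hk) (mem_filter.1 hkT).2.symm
      have hcont : Filter.Tendsto (fun δ : ℝ => w k + δ * (1 + c k)) (nhds 0) (nhds (w k)) := by
        have : Continuous fun δ : ℝ => w k + δ * (1 + c k) := by fun_prop
        simpa using this.tendsto 0
      exact (hcont.eventually (lt_mem_nhds hwk)).filter_mono nhdsWithin_le_nhds
    · have hck : c k = 0 := by
        have : k ∉ (t : Set ℕ) := fun hk' => hkT (htT hk')
        simp only [hc, this, dite_false]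
      filter_upwards [self_mem_nhdsWithin] with δ hδ
      have := hw0 k hk
      have hδ : 0 < δ := hδ
      rw [hck]
      linarith
  obtain ⟨δ, hδ⟩ := hev.exists
  refine ⟨_, hδ, ?_⟩
  simp only [add_smul, mul_smul, one_smul, smul_add, sum_add_distrib, ← smul_sum, hw, hcsum]
  simp

/-- Summation by parts. -/
lemma sum_smul_stepSum {n : ℕ} (v : Fin n → E) (K : ℕ) (w : ℕ → ℝ) :
    ∑ k ∈ Icc 1 K, w k • stepSum v k =
      ∑ i : Fin n, (∑ k ∈ range K, if (i : ℕ) ≤ k then w (k + 1) else 0) • v i := by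
  have h1 : ∀ f : ℕ → E, ∑ k ∈ Icc 1 K, f k = ∑ k ∈ range K, f (k + 1) := by
    intro f
    rw [range_eq_Ico, Finset.sum_Ico_add' f 0 K 1]
    rfl
  rw [h1]
  simp only [stepSum, smul_sum, sum_smul, sum_filter]
  rw [sum_comm]
  refine sum_congr rfl fun i _ => sum_congr rfl fun k _ => ?_
  simp only [Nat.lt_succ_iff, smul_ite, ite_smul, smul_zero, zero_smul]

lemma tail_sum_lt {K : ℕ} {w : ℕ → ℝ} (hw : ∀ k ∈ Icc 1 K, 0 < w k) {i j : ℕ} (hij : i < j)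
    (hi : i < K) : (∑ k ∈ range K, if j ≤ k then w (k + 1) else 0) <
      ∑ k ∈ range K, if i ≤ k then w (k + 1) else 0 := by
  have hpos : ∀ k ∈ range K, 0 < w (k + 1) := fun k hk => hw _ (by
    rw [mem_range] at hk
    rw [mem_Icc]
    omega)
  refine sum_lt_sum (fun k hk => ?_) ⟨i, by simpa using hi, ?_⟩
  · have := hpos k hk
    split_ifs
    · exact le_rfl
    · omega
    · linarith
    · exact le_rfl
  · rw [if_neg (by omega), if_pos le_rfl]
    exact hpos i (by simpa using hi)

/-- Positive relations between `S_1, …, S_n` are the relations between the increments with positive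
decreasing coefficients. -/
lemma exists_pos_combination_iff_strictAnti_pos {n : ℕ} (v : Fin n → E) :
    (∃ w : ℕ → ℝ, (∀ k ∈ Icc 1 n, 0 < w k) ∧ ∑ k ∈ Icc 1 n, w k • stepSum v k = 0) ↔
      ∃ y : Fin n → ℝ, StrictAnti y ∧ (∀ i, 0 < y i) ∧ ∑ i, y i • v i = 0 := by
  constructor
  · rintro ⟨w, hw, h⟩
    rw [sum_smul_stepSum] at h
    refine ⟨_, fun i j hij => tail_sum_lt hw hij i.2, fun i => ?_, h⟩
    refine lt_of_eq_of_lt ?_ (tail_sum_lt hw i.2 i.2)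
    rw [sum_eq_zero fun k hk => if_neg (by simpa using hk)]
  · rintro ⟨y, hanti, hpos, h⟩
    set Y : ℕ → ℝ := fun k => if h : k < n then y ⟨k, h⟩ else 0 with hY
    refine ⟨fun k => Y (k - 1) - Y k, fun k hk => ?_, ?_⟩
    · rw [mem_Icc] at hk
      have h1 : k - 1 < n := by omega
      simp only [hY, h1, dite_true, sub_pos]
      split_ifs with h2
      · exact hanti (Fin.mk_lt_mk.2 (by omega))
      · exact hpos _
    · rw [sum_smul_stepSum, ← h]
      refine sum_congr rfl fun i _ => ?_
      simp only [Nat.add_sub_cancel]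
      rw [tail_sum_telescope Y i.2.le]
      simp [hY]

/-- For a bridge, positive relations between `S_1, …, S_n` are the relations between the `n + 1`
increments with decreasing coefficients. -/
lemma exists_pos_combination_iff_strictAnti {n : ℕ} (v : Fin (n + 1) → E) (hv : ∑ i, v i = 0) :
    (∃ w : ℕ → ℝ, (∀ k ∈ Icc 1 n, 0 < w k) ∧ ∑ k ∈ Icc 1 n, w k • stepSum v k = 0) ↔
      ∃ y : Fin (n + 1) → ℝ, StrictAnti y ∧ ∑ i, y i • v i = 0 := by
  constructor
  · rintro ⟨w, hw, h⟩
    rw [sum_smul_stepSum] at h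
    exact ⟨_, fun i j hij => tail_sum_lt hw hij
      (lt_of_lt_of_le (Fin.lt_def.1 hij) (Nat.lt_succ_iff.1 j.2)), h⟩
  · rintro ⟨y, hanti, h⟩
    set Y : ℕ → ℝ := fun k => if h : k < n + 1 then y ⟨k, h⟩ else 0 with hY
    refine ⟨fun k => Y (k - 1) - Y k, fun k hk => ?_, ?_⟩
    · rw [mem_Icc] at hk
      have h1 : k - 1 < n + 1 := by omega
      have h2 : k < n + 1 := by omega
      simp only [hY, h1, h2, dite_true, sub_pos]
      exact hanti (Fin.mk_lt_mk.2 (by omega))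
    · rw [sum_smul_stepSum]
      -- The tails give the coefficients only up to the constant `Y n`, which is harmless because
      -- the increments sum to 0.
      have : ∀ i : Fin (n + 1), (∑ k ∈ range n,
          if (i : ℕ) ≤ k then (fun k => Y (k - 1) - Y k) (k + 1) else 0) • v i =
          y i • v i - Y n • v i := by
        intro i
        simp only [Nat.add_sub_cancel]
        rw [tail_sum_telescope Y (Nat.lt_succ_iff.1 i.2), ← sub_smul]
        simp [hY, Nat.lt_succ_iff.1 i.2]
      simp only [this, sum_sub_distrib, ← smul_sum, hv, h]
      simp

/-- The coefficients are matched by $x_{\sigma(i)}=\varepsilon_iy_i$. -/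
lemma exists_signedChamber_iff {n : ℕ} (v : Fin n → E)
    (g : Equiv.Perm (Fin n) × (Fin n → ℤˣ)) :
    (∃ y : Fin n → ℝ, StrictAnti y ∧ (∀ i, 0 < y i) ∧ ∑ i, y i • signedAct g v i = 0) ↔
      ∃ x ∈ relSpace v ⊥, SignedChamber g x := by
  have hsq : ∀ u : ℤˣ, ((u : ℤ) : ℝ) * ((u : ℤ) : ℝ) = 1 := by
    intro u
    rcases Int.units_eq_one_or u with rfl | rfl <;> simp
  have hact : ∀ (u : ℤˣ) (e : E), u • e = ((u : ℤ) : ℝ) • e := by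
    intro u e
    rcases Int.units_eq_one_or u with rfl | rfl <;> simp
  constructor
  · rintro ⟨y, hanti, hpos, h⟩
    set x : Fin n → ℝ := fun j => (((g.2 (g.1.symm j) : ℤˣ) : ℤ) : ℝ) * y (g.1.symm j) with hx
    have hxy : ∀ i, (((g.2 i : ℤˣ) : ℤ) : ℝ) * x (g.1 i) = y i := by
      intro i
      simp [hx, ← mul_assoc, hsq]
    refine ⟨x, ?_, ?_, ?_⟩
    · rw [mem_relSpace, Submodule.mem_bot, ← h, ← Equiv.sum_comp g.1]
      refine sum_congr rfl fun i _ => ?_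
      simp [signedAct, hact, smul_smul, hx, mul_comm]
    · simpa only [hxy] using hanti
    · simpa only [hxy] using hpos
  · rintro ⟨x, hx, hanti, hpos⟩
    refine ⟨_, hanti, hpos, ?_⟩
    rw [mem_relSpace, Submodule.mem_bot, ← Equiv.sum_comp g.1] at hx
    rw [← hx]
    refine sum_congr rfl fun i _ => ?_
    rw [signedAct, hact, smul_smul, mul_right_comm, hsq, one_mul]

/-- Relations of a bridge may be shifted by a constant; the coefficient of the last vector is
normalised to 0. -/
lemma exists_permChamber_iff {n : ℕ} (v : Fin (n + 1) → E) (hv : ∑ i, v i = 0)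
    (σ : Equiv.Perm (Fin (n + 1))) :
    (∃ y : Fin (n + 1) → ℝ, StrictAnti y ∧ ∑ i, y i • v (σ i) = 0) ↔
      ∃ x ∈ relSpace (fun i : Fin n => v i.castSucc) ⊥,
        StrictAnti fun i => (Fin.snoc x 0 : Fin (n + 1) → ℝ) (σ i) := by
  constructor
  · rintro ⟨y, hanti, h⟩
    set x : Fin n → ℝ := fun j => y (σ.symm j.castSucc) - y (σ.symm (Fin.last n)) with hx
    have hsnoc : ∀ j, (Fin.snoc x 0 : Fin (n + 1) → ℝ) j =
        y (σ.symm j) - y (σ.symm (Fin.last n)) := by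
      intro j
      refine Fin.lastCases ?_ (fun j => ?_) j <;> simp [hx]
    refine ⟨x, ?_, ?_⟩
    · have : ∑ i, (Fin.snoc x 0 : Fin (n + 1) → ℝ) i • v i = 0 := by
        simp only [hsnoc, sub_smul, sum_sub_distrib, ← smul_sum, hv, smul_zero, sub_zero]
        rw [← h, ← Equiv.sum_comp σ]
        simp
      rw [Fin.sum_univ_castSucc] at this
      rw [mem_relSpace, Submodule.mem_bot]
      simpa using this
    · simp only [hsnoc, Equiv.symm_apply_apply]
      exact fun i j hij => sub_lt_sub_right (hanti hij) _
  · rintro ⟨x, hx, hanti⟩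
    refine ⟨_, hanti, ?_⟩
    rw [Equiv.sum_comp σ fun i => (Fin.snoc x 0 : Fin (n + 1) → ℝ) i • v i, Fin.sum_univ_castSucc]
    rw [mem_relSpace, Submodule.mem_bot] at hx
    simpa using hx

/-- The number of signed permutations for which the hull of the rearranged walk contains `0`. -/
theorem ncard_zero_mem_sumsHull_signed [FiniteDimensional ℝ E] {n d : ℕ} {v : Fin (n + 1) → E}
    (hd : Module.finrank ℝ E = d) (hdn : d ≤ n + 1)
    (H : ∀ g, SumsGeneric (signedAct g v) (n + 1) d) :
    {g | 0 ∈ sumsHull (signedAct g v) (n + 1)}.ncard = regionCount 2 n d := by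
  have hset : {g | 0 ∈ sumsHull (signedAct g v) (n + 1)} =
      {g | ∃ x ∈ relSpace v ⊥, SignedChamber g x} := by
    ext g
    rw [Set.mem_ofPred_eq, Set.mem_ofPred_eq, ← exists_signedChamber_iff,
      ← exists_pos_combination_iff_strictAnti_pos]
    exact ⟨(H g).exists_pos_combination hd hdn,
      fun ⟨w, hw, h⟩ => zero_mem_sumsHull_of_pos (by omega) hw h⟩
  have hcard : signs.card = 2 := Finset.card_pair (by norm_num)
  rw [hset, ncard_signedChamber, ncard_regions_arrangement (by simp [signs]) ?_ ?_ n d v ⊥ ?_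
    (isGeneric_signs hd hdn H), hcard]
  · intro a ha b hb
    rw [mem_signs] at *
    rcases ha with rfl | rfl <;> rcases hb with rfl | rfl <;> norm_num
  · intro a ha
    rcases mem_signs.1 ha with rfl | rfl <;> norm_num
  · rw [← hd]
    exact (Submodule.quotEquivOfEqBot (⊥ : Submodule ℝ E) rfl).finrank_eq

/-- The number of permutations for which the hull of the rearranged bridge contains `0`. -/
theorem ncard_zero_mem_sumsHull_perm [FiniteDimensional ℝ E] {n d : ℕ} {v : Fin (n + 2) → E}
    (hd : Module.finrank ℝ E = d) (hdn : d ≤ n + 1) (hv : ∑ i, v i = 0)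
    (H : ∀ σ : Equiv.Perm (Fin (n + 2)), SumsGeneric (fun i => v (σ i)) (n + 1) d) :
    {σ : Equiv.Perm (Fin (n + 2)) | 0 ∈ sumsHull (fun i => v (σ i)) (n + 1)}.ncard =
      regionCount 1 n d := by
  have hset : {σ : Equiv.Perm (Fin (n + 2)) | 0 ∈ sumsHull (fun i => v (σ i)) (n + 1)} =
      {σ | ∃ x ∈ relSpace (fun i : Fin (n + 1) => v i.castSucc) ⊥,
        StrictAnti fun i => (Fin.snoc x 0 : Fin (n + 2) → ℝ) (σ i)} := by
    ext σ
    rw [Set.mem_ofPred_eq, Set.mem_ofPred_eq, ← exists_permChamber_iff v hv,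
      ← exists_pos_combination_iff_strictAnti _ (by rw [Equiv.sum_comp σ v, hv])]
    exact ⟨(H σ).exists_pos_combination hd hdn,
      fun ⟨w, hw, h⟩ => zero_mem_sumsHull_of_pos (by omega) hw h⟩
  rw [hset, ncard_permChamber, ncard_regions_arrangement (by simp) (by simp) (by simp) n d _ ⊥ ?_
    (isGeneric_one hd hdn H), card_singleton]
  rw [← hd]
  exact (Submodule.quotEquivOfEqBot (⊥ : Submodule ℝ E) rfl).finrank_eq

end GeneralPosition

/-! ### Reversing the last step: reduction of case D to case B. -/

section FlipLast

open Finset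

variable {E : Type*} [AddCommGroup E]

/-- Reverse the last vector of a configuration. -/
def flipLast {n : ℕ} (v : Fin n → E) : Fin n → E :=
  fun i => if (i : ℕ) + 1 = n then -v i else v i

lemma flipLast_flipLast {n : ℕ} (v : Fin n → E) : flipLast (flipLast v) = v := by
  ext i
  simp only [flipLast]
  split_ifs <;> simp

lemma stepSum_congr {n m : ℕ} (hnm : n ≤ m) {v : Fin n → E} {w : Fin m → E} {k : ℕ} (hk : k ≤ n)
    (h : ∀ i : Fin n, (i : ℕ) < k → v i = w (Fin.castLE hnm i)) : stepSum v k = stepSum w k := by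
  rw [stepSum, stepSum]
  refine sum_bij (fun i _ => Fin.castLE hnm i) ?_ ?_ ?_ ?_
  · intro i hi
    simpa using hi
  · intro a _ b _ hab
    exact Fin.castLE_injective hnm hab
  · intro j hj
    have hj : (j : ℕ) < k := by simpa using hj
    exact ⟨⟨j, by omega⟩, by simpa using hj, by ext; simp⟩
  · intro i hi
    exact h i (by simpa using hi)

lemma stepSum_flipLast {n k : ℕ} (v : Fin n → E) (hk : k < n) :
    stepSum (flipLast v) k = stepSum v k :=
  stepSum_congr le_rfl hk.le fun i hi => if_neg (by omega)

lemma stepSum_last {n : ℕ} (v : Fin (n + 1) → E) :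
    stepSum v (n + 1) = stepSum v n + v (Fin.last n) := by
  rw [stepSum, stepSum, sum_filter, sum_filter, Fin.sum_univ_castSucc, Fin.sum_univ_castSucc]
  simp only [Fin.val_castSucc, Fin.val_last, lt_irrefl, if_false, add_zero, Nat.lt_succ_self,
    if_true]
  congr 1
  refine sum_congr rfl fun i _ => ?_
  rw [if_pos i.2, if_pos (i.2.trans (Nat.lt_succ_self n))]

variable [Module ℝ E]

lemma stepSum_add_stepSum_flipLast {n : ℕ} (v : Fin (n + 1) → E) :
    stepSum v (n + 1) + stepSum (flipLast v) (n + 1) = (2 : ℝ) • stepSum v n := by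
  rw [stepSum_last, stepSum_last, stepSum_flipLast v (Nat.lt_succ_self n), two_smul]
  simp only [flipLast, Fin.val_last, if_true]
  abel

lemma sumsHull_congr {n m K : ℕ} {v : Fin n → E} {w : Fin m → E}
    (h : ∀ k ∈ Set.Icc 1 K, stepSum v k = stepSum w k) : sumsHull v K = sumsHull w K := by
  rw [sumsHull, sumsHull, Set.image_congr h]

lemma sumsHull_mono {n : ℕ} (v : Fin n → E) {K L : ℕ} (hKL : K ≤ L) :
    sumsHull v K ⊆ sumsHull v L :=
  convexHull_mono (Set.image_mono (Set.Icc_subset_Icc le_rfl hKL))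

/-- The smaller weight `b` is cancelled through $b(S_{n+2}+S_{n+2}^*)=2bS_{n+1}$, leaving $a-b\ge0$
on $S_{n+2}$ and the same total weight. -/
lemma zero_mem_sumsHull_of_flip_weights {n : ℕ} (v : Fin (n + 2) → E) {w : ℕ → ℝ} {a b : ℝ}
    (hw : ∀ k ∈ Icc 1 (n + 1), 0 ≤ w k) (hb : 0 ≤ b) (hab : b ≤ a)
    (h1 : ∑ k ∈ Icc 1 (n + 1), w k + a + b = 1)
    (h0 : ∑ k ∈ Icc 1 (n + 1), w k • stepSum v k + a • stepSum v (n + 2) +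
      b • stepSum (flipLast v) (n + 2) = 0) : 0 ∈ sumsHull v (n + 2) := by
  have hflip : stepSum (flipLast v) (n + 2) = (2 : ℝ) • stepSum v (n + 1) - stepSum v (n + 2) :=
    eq_sub_of_add_eq' (stepSum_add_stepSum_flipLast v)
  set u : ℕ → ℝ := fun k =>
    if k = n + 2 then a - b else if k = n + 1 then w (n + 1) + 2 * b else w k with hu
  have hu2 : u (n + 2) = a - b := by simp [hu]
  have hu1 : u (n + 1) = w (n + 1) + 2 * b := by simp [hu]
  have hu0 : ∀ k ∈ Icc 1 n, u k = w k := by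
    intro k hk
    rw [mem_Icc] at hk
    simp only [hu]
    rw [if_neg (by omega), if_neg (by omega)]
  rw [sum_Icc_succ_top (by omega)] at h1 h0
  refine mem_sumsHull_iff.2 ⟨u, fun k hk => ?_, ?_, ?_⟩
  · rw [mem_Icc] at hk
    simp only [hu]
    split_ifs with h h'
    · linarith
    · have := hw (n + 1) (by simp)
      linarith
    · exact hw k (by rw [mem_Icc]; omega)
  · rw [sum_Icc_succ_top (by omega), sum_Icc_succ_top (by omega), hu2, hu1, sum_congr rfl hu0]
    linarith
  · rw [sum_Icc_succ_top (by omega), sum_Icc_succ_top (by omega), hu2, hu1,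
      sum_congr rfl fun k hk => by rw [hu0 k hk]]
    rw [hflip] at h0
    rw [← h0]
    module

/-- The hull of type `D_n` is the union of two hulls of type `B_n`, as far as `0` is concerned. -/
lemma zero_mem_convexHull_insert_iff {n : ℕ} (v : Fin (n + 2) → E) :
    0 ∈ convexHull ℝ (insert (stepSum (flipLast v) (n + 2)) (stepSum v '' Set.Icc 1 (n + 2))) ↔
      0 ∈ sumsHull v (n + 2) ∨ 0 ∈ sumsHull (flipLast v) (n + 2) := by
  constructor
  · intro h
    -- The reversed sum is stored at the extra index `n + 3`.
    set f : ℕ → E := fun k => if k = n + 3 then stepSum (flipLast v) (n + 2) else stepSum v k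
      with hf
    have himg : insert (stepSum (flipLast v) (n + 2)) (stepSum v '' Set.Icc 1 (n + 2)) ⊆
        f '' (Icc 1 (n + 3) : Finset ℕ) := by
      rw [Set.insert_subset_iff]
      refine ⟨⟨n + 3, by simp, by simp [hf]⟩, ?_⟩
      rintro _ ⟨k, hk, rfl⟩
      rw [Set.mem_Icc] at hk
      refine ⟨k, by simp; omega, ?_⟩
      simp only [hf]
      rw [if_neg (by omega)]
    obtain ⟨w, hw0, hw1, hw⟩ := mem_convexHull_image_finset.1 (convexHull_mono himg h)
    have hfk : ∀ k ∈ Icc 1 (n + 1), w k • f k = w k • stepSum v k := by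
      intro k hk
      rw [mem_Icc] at hk
      simp only [hf]
      rw [if_neg (by omega)]
    rw [sum_Icc_succ_top (by omega), sum_Icc_succ_top (by omega)] at hw1 hw
    rw [sum_congr rfl hfk] at hw
    simp only [hf, if_true] at hw
    rw [if_neg (by omega)] at hw
    have hwk : ∀ k ∈ Icc 1 (n + 1), 0 ≤ w k := fun k hk => hw0 k (by rw [mem_Icc] at *; omega)
    have ha := hw0 (n + 2) (by simp)
    have hb := hw0 (n + 3) (by simp)
    rcases le_total (w (n + 3)) (w (n + 2)) with hle | hle
    · exact Or.inl (zero_mem_sumsHull_of_flip_weights v hwk hb hle hw1 hw)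
    · refine Or.inr (zero_mem_sumsHull_of_flip_weights (flipLast v) hwk ha hle ?_ ?_)
      · linarith
      · rw [flipLast_flipLast, ← hw, add_right_comm]
        congr 2
        refine sum_congr rfl fun k hk => ?_
        rw [mem_Icc] at hk
        rw [stepSum_flipLast v (by omega)]
  · rintro (h | h)
    · exact convexHull_mono (Set.subset_insert _ _) h
    · refine convexHull_mono ?_ h
      rintro _ ⟨k, hk, rfl⟩
      rw [Set.mem_Icc] at hk
      rcases hk.2.eq_or_lt with rfl | hlt
      · exact Set.mem_insert _ _
      · exact Set.mem_insert_of_mem _ ⟨k, Set.mem_Icc.2 hk, (stepSum_flipLast v hlt).symm⟩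

/-- General position gives positive weights $\alpha,\beta$ on the last sums of the two walks. In
$\beta$ times one relation plus $\alpha$ times the other, these two sums merge into $2\alpha\beta
S_{n+1}$. -/
lemma zero_mem_sumsHull_and_flipLast_iff [FiniteDimensional ℝ E] {n d : ℕ} {v : Fin (n + 2) → E}
    (hd : Module.finrank ℝ E = d) (hdn : d ≤ n + 2) (h : SumsGeneric v (n + 2) d)
    (h' : SumsGeneric (flipLast v) (n + 2) d) :
    (0 ∈ sumsHull v (n + 2) ∧ 0 ∈ sumsHull (flipLast v) (n + 2)) ↔ 0 ∈ sumsHull v (n + 1) := by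
  constructor
  · rintro ⟨h0, h0'⟩
    obtain ⟨w, hw, hws⟩ := h.exists_pos_combination hd hdn h0
    obtain ⟨w', hw', hws'⟩ := h'.exists_pos_combination hd hdn h0'
    have hflip : stepSum (flipLast v) (n + 2) = (2 : ℝ) • stepSum v (n + 1) - stepSum v (n + 2) :=
      eq_sub_of_add_eq' (stepSum_add_stepSum_flipLast v)
    have hα := hw (n + 2) (by simp)
    have hβ := hw' (n + 2) (by simp)
    set α := w (n + 2)
    set β := w' (n + 2)
    rw [sum_Icc_succ_top (by omega)] at hws hws'
    have hcongr : ∑ k ∈ Icc 1 (n + 1), w' k • stepSum (flipLast v) k =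
        ∑ k ∈ Icc 1 (n + 1), w' k • stepSum v k := by
      refine sum_congr rfl fun k hk => ?_
      rw [mem_Icc] at hk
      rw [stepSum_flipLast v (by omega)]
    rw [hcongr, hflip] at hws'
    refine zero_mem_sumsHull_of_pos (by omega)
      (w := fun k => β * w k + α * w' k + if k = n + 1 then 2 * α * β else 0) (fun k hk => ?_) ?_
    · have h1 := hw k (by rw [mem_Icc] at *; omega)
      have h2 := hw' k (by rw [mem_Icc] at *; omega)
      split_ifs <;> positivity
    · have hlast : ∑ k ∈ Icc 1 (n + 1), (if k = n + 1 then 2 * α * β else 0) • stepSum v k =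
          (2 * α * β) • stepSum v (n + 1) := by
        simp [ite_smul]
      simp only [add_smul, mul_smul β, mul_smul α, sum_add_distrib, ← smul_sum]
      rw [hlast]
      have e1 := congrArg (fun x => β • x) hws
      have e2 := congrArg (fun x => α • x) hws'
      simp only [smul_zero] at e1 e2
      rw [← add_zero (0 : E)]
      nth_rewrite 1 [← e1]
      rw [← e2]
      module
  · intro h0
    refine ⟨sumsHull_mono v (by omega) h0, sumsHull_mono _ (Nat.le_succ (n + 1)) ?_⟩
    rwa [sumsHull_congr fun k hk => stepSum_flipLast v (by rw [Set.mem_Icc] at hk; omega)]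

end FlipLast

/-! ### Measurability and averaging over the group. -/

section Probability

open MeasureTheory ProbabilityTheory

variable {d : ℕ}

local notation "𝔼" => EuclideanSpace ℝ (Fin d)

lemma continuous_stepSum {n : ℕ} (k : ℕ) : Continuous fun v : Fin n → 𝔼 => stepSum v k := by
  unfold stepSum
  fun_prop

/-- By separation, 0 is outside the hull of finitely many points iff some functional is positive at
all of them, an open condition on the points. -/
lemma isOpen_zero_notMem_sumsHull (n K : ℕ) : IsOpen {v : Fin n → 𝔼 | 0 ∉ sumsHull v K} := by
  have : {v : Fin n → 𝔼 | 0 ∉ sumsHull v K} =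
      ⋃ f : StrongDual ℝ 𝔼, ⋂ k ∈ Set.Icc 1 K, {v | 0 < f (stepSum v k)} := by
    ext v
    simp only [Set.mem_ofPred_eq, Set.mem_iUnion, Set.mem_iInter]
    constructor
    · intro h
      have hfin : (stepSum v '' Set.Icc 1 K).Finite := (Set.finite_Icc 1 K).image _
      obtain ⟨f, u, hf0, hf⟩ := geometric_hahn_banach_point_closed
        (convex_convexHull ℝ (stepSum v '' Set.Icc 1 K)) (hfin.isClosed_convexHull ℝ) h
      refine ⟨f, fun k hk => ?_⟩
      have := hf _ (subset_convexHull ℝ _ ⟨k, hk, rfl⟩)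
      simp only [map_zero] at hf0
      linarith
    · rintro ⟨f, hf⟩ h
      have hsub : sumsHull v K ⊆ {x | 0 < f x} := by
        refine convexHull_min ?_ (convex_halfSpace_gt f.toLinearMap.isLinear 0)
        rintro _ ⟨k, hk, rfl⟩
        exact hf k hk
      have := hsub h
      simp at this
  rw [this]
  refine isOpen_iUnion fun f => (Set.finite_Icc 1 K).isOpen_biInter fun k _ => ?_
  exact isOpen_lt continuous_const (f.continuous.comp (continuous_stepSum k))

lemma measurableSet_zero_mem_sumsHull (n K : ℕ) :
    MeasurableSet {v : Fin n → 𝔼 | 0 ∈ sumsHull v K} := by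
  have := (isOpen_zero_notMem_sumsHull (d := d) n K).measurableSet.compl
  convert this using 1
  ext v
  simp

lemma measurableSet_sumsGeneric (n K : ℕ) :
    MeasurableSet {v : Fin n → 𝔼 | SumsGeneric v K d} := by
  have : {v : Fin n → 𝔼 | SumsGeneric v K d} = ⋂ s : Fin d → ℕ, ⋂ _ : Function.Injective s,
      ⋂ _ : ∀ j, s j ∈ Set.Icc 1 K, {v | LinearIndependent ℝ fun j => stepSum v (s j)} := by
    ext v
    simp only [Set.mem_iInter]
    rfl
  rw [this]
  refine MeasurableSet.iInter fun s => MeasurableSet.iInter fun _ => MeasurableSet.iInter fun _ => ?_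
  exact (isOpen_setOfPred_linearIndependent.preimage
    (continuous_pi fun j => continuous_stepSum (s j))).measurableSet

lemma measurable_signedAct {n : ℕ} (g : Equiv.Perm (Fin n) × (Fin n → ℤˣ)) :
    Measurable fun v : Fin n → 𝔼 => signedAct g v := by
  refine measurable_pi_lambda _ fun i => ?_
  have : Measurable fun v : Fin n → 𝔼 => v (g.1 i) := measurable_pi_apply _
  rcases Int.units_eq_one_or (g.2 i) with h | h
  · simpa [signedAct, h] using this
  · have := this.neg
    simp only [signedAct, h, Units.neg_smul, one_smul]
    exact this

lemma flipLast_eq_signedAct {n : ℕ} (v : Fin n → 𝔼) :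
    flipLast v = signedAct (1, fun i => if (i : ℕ) + 1 = n then -1 else 1) v := by
  ext i : 1
  simp only [flipLast, signedAct, Equiv.Perm.one_apply]
  split_ifs <;> simp

lemma measurable_flipLast {n : ℕ} : Measurable fun v : Fin n → 𝔼 => flipLast v := by
  simp only [flipLast_eq_signedAct]
  exact measurable_signedAct _

variable {Ω : Type*} [MeasurableSpace Ω] {P : Measure Ω}

lemma InGeneralPosition.ae_sumsGeneric {n K : ℕ} {X : Ω → Fin n → 𝔼}
    {V : ℕ → Ω → 𝔼} (h : InGeneralPosition P (Set.Icc 1 K) V)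
    (hV : ∀ k ∈ Set.Icc 1 K, ∀ ω, V k ω = stepSum (X ω) k) :
    ∀ᵐ ω ∂P, SumsGeneric (X ω) K d := by
  unfold SumsGeneric
  rw [ae_all_iff]
  intro s
  by_cases h1 : Function.Injective s
  · by_cases h2 : ∀ j, s j ∈ Set.Icc 1 K
    · filter_upwards [h s h1 h2] with ω hω _ _
      simpa only [hV _ (h2 _)] using hω
    · exact Filter.Eventually.of_forall fun ω _ h2' => absurd h2' h2
  · exact Filter.Eventually.of_forall fun ω h1' => absurd h1' h1

/-- Summing probabilities over a family of events of which almost surely exactly `N` occur. -/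
lemma sum_measureReal_eq_of_ncard [IsProbabilityMeasure P] {G : Type*} [Fintype G]
    {S : G → Set Ω} (hS : ∀ g, MeasurableSet (S g)) {N : ℕ}
    (hN : ∀ᵐ ω ∂P, {g | ω ∈ S g}.ncard = N) : ∑ g, P.real (S g) = N := by
  classical
  have h1 : ∀ g, P.real (S g) = ∫ ω, (S g).indicator (fun _ => (1 : ℝ)) ω ∂P := fun g =>
    (integral_indicator_one (hS g)).symm
  simp only [h1]
  rw [← integral_finsetSum _ fun g _ => (integrable_const (1 : ℝ)).indicator (hS g)]
  have h2 : (fun ω => ∑ g, (S g).indicator (fun _ => (1 : ℝ)) ω) =ᵐ[P] fun _ => (N : ℝ) := by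
    filter_upwards [hN] with ω hω
    rw [← hω, Set.ncard_eq_toFinset_card']
    simp [Set.indicator_apply]
  rw [integral_congr_ae h2]
  simp

lemma card_signedPerm (n : ℕ) :
    (Fintype.card (Equiv.Perm (Fin n) × (Fin n → ℤˣ)) : ℝ) = 2 ^ n * n.factorial := by
  simp [Fintype.card_perm, mul_comm]

lemma sum_measureReal_signedAct [IsProbabilityMeasure P] {n : ℕ} {X : Ω → Fin (n + 1) → 𝔼}
    (hX : Measurable X) (hdn : d ≤ n + 1)
    (hgen : ∀ᵐ ω ∂P, ∀ g, SumsGeneric (signedAct g (X ω)) (n + 1) d) :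
    ∑ g, P.real {ω | 0 ∈ sumsHull (signedAct g (X ω)) (n + 1)} = regionCount 2 n d := by
  refine sum_measureReal_eq_of_ncard (fun g =>
    ((measurable_signedAct g).comp hX) (measurableSet_zero_mem_sumsHull _ _)) ?_
  filter_upwards [hgen] with ω hω
  exact ncard_zero_mem_sumsHull_signed (by simp) hdn hω

lemma measureReal_compl_hull [IsProbabilityMeasure P] {n K : ℕ} {X : Ω → Fin n → 𝔼}
    (hX : Measurable X) :
    P.real {ω | 0 ∉ sumsHull (X ω) K} = 1 - P.real {ω | 0 ∈ sumsHull (X ω) K} := by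
  exact probReal_compl_eq_one_sub (μ := P) (hX (measurableSet_zero_mem_sumsHull n K))

/-! ### Exact miss probabilities in the three cases. -/

/-- The probability that the hull of a symmetric walk with `n + 1` steps does not contain `0`. -/
noncomputable def missProbB (n d : ℕ) : ℝ :=
  1 - regionCount 2 n d / (2 ^ (n + 1) * (n + 1).factorial)

/-- The probability that the hull of a bridge with `n + 2` steps does not contain `0`. -/
noncomputable def missProbA (n d : ℕ) : ℝ :=
  1 - regionCount 1 n d / (n + 2).factorial

/-- General position depends only on the law, so almost surely it holds for all rearrangements at
once and the count is constant. All summands of `sum_measureReal_signedAct` are equal by invariance.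
-/
theorem TypeB.measureReal_eq [IsProbabilityMeasure P] {n : ℕ} {ξ : Fin (n + 1) → Ω → 𝔼}
    (h : TypeB P ξ) : P.real {ω | 0 ∉ hullB (ξ) ω} = missProbB n d := by
  set X : Ω → Fin (n + 1) → 𝔼 := fun ω i => ξ i ω with hXdef
  have hX : Measurable X := measurable_pi_lambda _ h.measurable
  have hid : ∀ g, IdentDistrib X (fun ω => signedAct g (X ω)) P P := fun g =>
    h.symmExchangeable g.1 g.2
  have hgen : ∀ᵐ ω ∂P, ∀ g, SumsGeneric (signedAct g (X ω)) (n + 1) d := by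
    rw [ae_all_iff]
    intro g
    exact (hid g).ae_mem_snd (measurableSet_sumsGeneric _ _)
      (h.generalPosition.ae_sumsGeneric (X := X) fun k _ ω => rfl)
  have hsum := sum_measureReal_signedAct hX h.dim_le hgen
  have heq : ∀ g, P.real {ω | 0 ∈ sumsHull (signedAct g (X ω)) (n + 1)} =
      P.real {ω | 0 ∈ sumsHull (X ω) (n + 1)} := fun g =>
    congrArg ENNReal.toReal ((hid g).measure_mem_eq (measurableSet_zero_mem_sumsHull _ _)).symm
  simp only [heq, Finset.sum_const, Finset.card_univ, nsmul_eq_mul, card_signedPerm] at hsum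
  change P.real {ω | 0 ∉ sumsHull (X ω) (n + 1)} = _
  rw [measureReal_compl_hull hX, missProbB, ← hsum, mul_div_cancel_left₀]
  positivity

theorem TypeA.measureReal_eq [IsProbabilityMeasure P] {n : ℕ} {ξ : Fin (n + 2) → Ω → 𝔼}
    (h : TypeA P ξ) : P.real {ω | 0 ∉ hullA (ξ) ω} = missProbA n d := by
  set X : Ω → Fin (n + 2) → 𝔼 := fun ω i => ξ i ω with hXdef
  have hX : Measurable X := measurable_pi_lambda _ h.measurable
  have hperm : ∀ σ : Equiv.Perm (Fin (n + 2)), Measurable fun v : Fin (n + 2) → 𝔼 =>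
      fun i => v (σ i) := fun σ => measurable_pi_lambda _ fun i => measurable_pi_apply _
  have hid : ∀ σ : Equiv.Perm (Fin (n + 2)), IdentDistrib X (fun ω i => X ω (σ i)) P P :=
    h.exchangeable
  have hgen : ∀ᵐ ω ∂P, ∀ σ : Equiv.Perm (Fin (n + 2)),
      SumsGeneric (fun i => X ω (σ i)) (n + 1) d := by
    rw [ae_all_iff]
    intro σ
    exact (hid σ).ae_mem_snd (measurableSet_sumsGeneric _ _)
      (h.generalPosition.ae_sumsGeneric (X := X) fun k _ ω => rfl)
  have hdn : d ≤ n + 1 := by have := h.dim_le; omega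
  have hsum : ∑ σ : Equiv.Perm (Fin (n + 2)),
      P.real {ω | 0 ∈ sumsHull (fun i => X ω (σ i)) (n + 1)} = regionCount 1 n d := by
    refine sum_measureReal_eq_of_ncard (fun σ =>
      ((hperm σ).comp hX) (measurableSet_zero_mem_sumsHull _ _)) ?_
    filter_upwards [hgen, h.sum_eq_zero] with ω hω h0
    refine ncard_zero_mem_sumsHull_perm (by simp) hdn ?_ hω
    rw [← h0, partialSum, Finset.filter_true_of_mem fun i _ => i.2]
  have heq : ∀ σ : Equiv.Perm (Fin (n + 2)),
      P.real {ω | 0 ∈ sumsHull (fun i => X ω (σ i)) (n + 1)} =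
      P.real {ω | 0 ∈ sumsHull (X ω) (n + 1)} := fun σ =>
    congrArg ENNReal.toReal ((hid σ).measure_mem_eq (measurableSet_zero_mem_sumsHull _ _)).symm
  simp only [heq, Finset.sum_const, Finset.card_univ, nsmul_eq_mul, Fintype.card_perm,
    Fintype.card_fin] at hsum
  change P.real {ω | 0 ∉ sumsHull (X ω) (n + 1)} = _
  rw [measureReal_compl_hull hX, missProbA, ← hsum, mul_div_cancel_left₀]
  positivity

/-- Deleting the last step of a walk of type `D_{n+1}` gives a walk of type `B_n`. -/
lemma TypeD.typeB_init {n : ℕ} {ξ : Fin (n + 1) → Ω → 𝔼} (h : TypeD P ξ) (hdn : d ≤ n) :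
    TypeB P fun i : Fin n => ξ i.castSucc where
  measurable i := h.measurable _
  symmExchangeable σ ε := by
    set σ' : Equiv.Perm (Fin (n + 1)) :=
      finSuccEquivLast.symm.permCongr (Equiv.optionCongr σ) with hσ'
    -- The free last sign is chosen to make the total number of sign changes even.
    set ε' : Fin (n + 1) → ℤˣ := Fin.snoc ε (∏ i, ε i) with hε'
    have hprod : ∏ i, ε' i = 1 := by
      rw [Fin.prod_univ_castSucc]
      simp [hε', Int.units_mul_self]
    have hσ : ∀ i : Fin n, σ' i.castSucc = (σ i).castSucc := by
      intro i
      simp [hσ', Equiv.permCongr_apply]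
    have := (h.evenSymmExchangeable σ' ε' hprod).comp
      (u := fun v : Fin (n + 1) → 𝔼 => fun i : Fin n => v i.castSucc)
      (measurable_pi_lambda _ fun i => measurable_pi_apply _)
    simpa only [Function.comp_def, hσ, hε', Fin.snoc_castSucc] using this
  dim_le := hdn
  generalPosition s hs hmem := by
    have := h.generalPosition s hs fun j => ⟨(hmem j).1, (hmem j).2.trans (Nat.le_succ n)⟩
    filter_upwards [this] with ω hω
    have e : ∀ k ∈ Set.Icc 1 n, partialSum (fun i : Fin n => ξ i.castSucc) k ω =
        partialSum ξ k ω := fun k hk =>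
      stepSum_congr (v := fun i : Fin n => ξ i.castSucc ω) (w := fun i => ξ i ω) (Nat.le_succ n)
        hk.2 fun i _ => rfl
    simpa only [e _ (hmem _)] using hω

/-- Reversing the last sign of a signed permutation. -/
def flipSign {n : ℕ} (g : Equiv.Perm (Fin n) × (Fin n → ℤˣ)) :
    Equiv.Perm (Fin n) × (Fin n → ℤˣ) :=
  (g.1, fun i => if (i : ℕ) + 1 = n then -g.2 i else g.2 i)

lemma flipSign_involutive {n : ℕ} : Function.Involutive (flipSign (n := n)) := by
  intro g
  refine Prod.ext rfl (funext fun i => ?_)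
  simp only [flipSign]
  split_ifs <;> simp

lemma signedAct_flipSign {n : ℕ} (g : Equiv.Perm (Fin n) × (Fin n → ℤˣ)) (v : Fin n → 𝔼) :
    signedAct (flipSign g) v = flipLast (signedAct g v) := by
  ext i : 1
  simp only [signedAct, flipSign, flipLast]
  split_ifs <;> simp

lemma prod_flipSign {n : ℕ} (g : Equiv.Perm (Fin (n + 1)) × (Fin (n + 1) → ℤˣ)) :
    ∏ i, (flipSign g).2 i = -∏ i, g.2 i := by
  rw [Fin.prod_univ_castSucc, Fin.prod_univ_castSucc]
  have : ∀ i : Fin n, (flipSign g).2 i.castSucc = g.2 i.castSucc := by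
    intro i
    simp only [flipSign]
    rw [if_neg]
    have := i.2
    simp only [Fin.val_castSucc]
    omega
  rw [Finset.prod_congr rfl fun i _ => this i]
  simp [flipSign]

theorem TypeD.measureReal_eq [IsProbabilityMeasure P] {n : ℕ} {ξ : Fin (n + 2) → Ω → 𝔼}
    (h : TypeD P ξ) (hdn : d ≤ n + 1) :
    P.real {ω | 0 ∉ hullD (ξ) ω} = 2 * missProbB (n + 1) d - missProbB n d := by
  set X : Ω → Fin (n + 2) → 𝔼 := fun ω i => ξ i ω with hXdef
  have hX : Measurable X := measurable_pi_lambda _ h.measurable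
  have hfX : Measurable fun ω => flipLast (X ω) := measurable_flipLast.comp hX
  have hid : ∀ g : Equiv.Perm (Fin (n + 2)) × (Fin (n + 2) → ℤˣ), ∏ i, g.2 i = 1 →
      IdentDistrib X (fun ω => signedAct g (X ω)) P P := fun g hg =>
    h.evenSymmExchangeable g.1 g.2 hg
  have hfid : ∀ g : Equiv.Perm (Fin (n + 2)) × (Fin (n + 2) → ℤˣ), ∏ i, g.2 i = 1 →
      IdentDistrib (fun ω => flipLast (X ω)) (fun ω => signedAct (flipSign g) (X ω)) P P := by
    intro g hg
    simp only [signedAct_flipSign]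
    exact (hid g hg).comp measurable_flipLast
  have heven : ∀ g : Equiv.Perm (Fin (n + 2)) × (Fin (n + 2) → ℤˣ),
      ∏ i, g.2 i = 1 ∨ ∏ i, (flipSign g).2 i = 1 := by
    intro g
    rw [prod_flipSign]
    rcases Int.units_eq_one_or (∏ i, g.2 i) with h | h <;> simp [h]
  have hsumsX : ∀ᵐ ω ∂P, SumsGeneric (X ω) (n + 2) d :=
    h.generalPosition.ae_sumsGeneric (X := X) fun k _ ω => rfl
  have hflipped : ∀ ω, flippedSum ξ ω = stepSum (flipLast (X ω)) (n + 2) := by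
    intro ω
    rw [flippedSum, stepSum, Finset.filter_true_of_mem fun i _ => i.2]
    rfl
  have hsumsfX : ∀ᵐ ω ∂P, SumsGeneric (flipLast (X ω)) (n + 2) d := by
    refine h.generalPosition_flipped.ae_sumsGeneric (X := fun ω => flipLast (X ω))
      fun k hk ω => ?_
    rcases hk.2.eq_or_lt with rfl | hlt
    · rw [Function.update_self, hflipped]
    · rw [Function.update_of_ne hlt.ne, stepSum_flipLast _ hlt]
      rfl
  have hgen : ∀ᵐ ω ∂P, ∀ g, SumsGeneric (signedAct g (X ω)) (n + 2) d := by
    rw [ae_all_iff]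
    intro g
    rcases heven g with hg | hg
    · exact (hid g hg).ae_mem_snd (measurableSet_sumsGeneric _ _) hsumsX
    · have := hfid _ hg
      rw [flipSign_involutive g] at this
      exact this.ae_mem_snd (measurableSet_sumsGeneric _ _) hsumsfX
  set p : (Equiv.Perm (Fin (n + 2)) × (Fin (n + 2) → ℤˣ)) → ℝ :=
    fun g => P.real {ω | 0 ∈ sumsHull (signedAct g (X ω)) (n + 2)} with hp
  set a := P.real {ω | 0 ∈ sumsHull (X ω) (n + 2)} with ha
  set b := P.real {ω | 0 ∈ sumsHull (flipLast (X ω)) (n + 2)} with hb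
  have hsum : ∑ g, p g = regionCount 2 (n + 1) d :=
    sum_measureReal_signedAct hX (by omega) hgen
  have hsum' : ∑ g, p (flipSign g) = regionCount 2 (n + 1) d := by
    rw [← hsum]
    exact Equiv.sum_comp flipSign_involutive.toPerm p
  have hM := measurableSet_zero_mem_sumsHull (d := d) (n + 2) (n + 2)
  -- Exactly one of `g`, `flipSign g` is even. The even one gives a walk with the law of `X`, the
  -- other a walk with the law of `flipLast X`.
  have hpair : ∀ g, p g + p (flipSign g) = a + b := by
    have key : ∀ g : Equiv.Perm (Fin (n + 2)) × (Fin (n + 2) → ℤˣ), ∏ i, g.2 i = 1 →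
        p g + p (flipSign g) = a + b := by
      intro g hg
      have h1 : p g = a := congrArg ENNReal.toReal ((hid g hg).measure_mem_eq hM).symm
      have h2 : p (flipSign g) = b := congrArg ENNReal.toReal ((hfid g hg).measure_mem_eq hM).symm
      rw [h1, h2]
    intro g
    rcases heven g with hg | hg
    · exact key g hg
    · have := key _ hg
      rwa [flipSign_involutive g, add_comm] at this
  have hab : a + b = 2 * (1 - missProbB (n + 1) d) := by
    have : ∑ g, (p g + p (flipSign g)) = 2 * regionCount 2 (n + 1) d := by
      rw [Finset.sum_add_distrib, hsum, hsum']
      ring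
    simp only [hpair, Finset.sum_const, Finset.card_univ, nsmul_eq_mul, card_signedPerm] at this
    rw [missProbB, sub_sub_cancel, ← mul_div_assoc, ← this, mul_div_cancel_left₀]
    positivity
  have hinter : P.real ({ω | 0 ∈ sumsHull (X ω) (n + 2)} ∩
      {ω | 0 ∈ sumsHull (flipLast (X ω)) (n + 2)}) = 1 - missProbB n d := by
    have hB := (h.typeB_init hdn).measureReal_eq
    change P.real {ω | 0 ∉ sumsHull (fun i : Fin (n + 1) => X ω i.castSucc) (n + 1)} = _ at hB
    have hinit : Measurable fun ω => fun i : Fin (n + 1) => X ω i.castSucc :=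
      measurable_pi_lambda _ fun i => (measurable_pi_apply _).comp hX
    rw [measureReal_compl_hull hinit] at hB
    rw [← hB, sub_sub_cancel]
    refine congrArg ENNReal.toReal (measure_congr ?_)
    filter_upwards [hsumsX, hsumsfX] with ω h1 h2
    refine propext ?_
    change (0 ∈ sumsHull (X ω) (n + 2) ∧ 0 ∈ sumsHull (flipLast (X ω)) (n + 2)) ↔
      0 ∈ sumsHull (fun i : Fin (n + 1) => X ω i.castSucc) (n + 1)
    rw [zero_mem_sumsHull_and_flipLast_iff (by simp) (by omega) h1 h2,
      sumsHull_congr (v := fun i : Fin (n + 1) => X ω i.castSucc) (w := X ω) fun k hk =>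
        stepSum_congr (Nat.le_succ _) hk.2 fun i _ => rfl]
  have hset : {ω | 0 ∉ hullD ξ ω} = ({ω | 0 ∈ sumsHull (X ω) (n + 2)} ∪
      {ω | 0 ∈ sumsHull (flipLast (X ω)) (n + 2)})ᶜ := by
    ext ω
    have := zero_mem_convexHull_insert_iff (X ω)
    rw [← hflipped] at this
    exact not_congr this
  rw [hset]
  refine (probReal_compl_eq_one_sub (μ := P) ((hX hM).union (hfX hM))).trans ?_
  have hunion := measureReal_union_add_inter (μ := P)
    (s := {ω | 0 ∈ sumsHull (X ω) (n + 2)}) (hfX hM)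
  have : P.real ({ω | 0 ∈ sumsHull (X ω) (n + 2)} ∪
      {ω | 0 ∈ sumsHull (flipLast (X ω)) (n + 2)}) + (1 - missProbB n d) = a + b := by
    rw [← hinter]
    exact hunion
  change 1 - P.real ({ω | 0 ∈ sumsHull (X ω) (n + 2)} ∪
      {ω | 0 ∈ sumsHull (flipLast (X ω)) (n + 2)}) = _
  linarith

end Probability

/-! ### Asymptotics of the Pascal-type recursions. -/

section Asymptotics

open Filter Topology Asymptotics Finset

/-- A form of the Stolz–Cesàro theorem. -/
lemma tendsto_div_of_tendsto_diff_div {u L : ℕ → ℝ} {ℓ : ℝ} (hL : Monotone L)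
    (hLtop : Tendsto L atTop atTop) (hne : ∀ᶠ n in atTop, L (n + 1) - L n ≠ 0)
    (h : Tendsto (fun n => (u (n + 1) - u n) / (L (n + 1) - L n)) atTop (𝓝 ℓ)) :
    Tendsto (fun n => u n / L n) atTop (𝓝 ℓ) := by
  have hg : (0 : ℕ → ℝ) ≤ fun n => L (n + 1) - L n := fun n => sub_nonneg.2 (hL (Nat.le_succ n))
  have hsumL : ∀ n, ∑ i ∈ range n, (L (i + 1) - L i) = L n - L 0 := fun n => sum_range_sub L n
  have hLtop' : Tendsto (fun n => L n - L 0) atTop atTop :=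
    tendsto_atTop_add_const_right _ _ hLtop
  have h1 : (fun n => (u (n + 1) - u n) - ℓ * (L (n + 1) - L n)) =o[atTop]
      fun n => L (n + 1) - L n := by
    refine (isLittleO_iff_tendsto' (hne.mono fun n hn h0 => absurd h0 hn)).2 ?_
    have h2 := h.sub_const ℓ
    rw [sub_self] at h2
    refine h2.congr' ?_
    filter_upwards [hne] with n hn
    field_simp
  have h3 := h1.sum_range hg (by simpa only [hsumL] using hLtop')
  have hsum : ∀ n, ∑ i ∈ range n, ((u (i + 1) - u i) - ℓ * (L (i + 1) - L i)) =
      (u n - u 0) - ℓ * (L n - L 0) := fun n => by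
    rw [sum_sub_distrib, sum_range_sub, ← mul_sum, hsumL]
  simp only [hsum, hsumL] at h3
  have h4 := h3.tendsto_div_nhds_zero
  have hLpos := hLtop.eventually_gt_atTop 0
  have hLpos' := hLtop'.eventually_gt_atTop 0
  have h5 : Tendsto (fun n => (L n - L 0) / L n) atTop (𝓝 1) := by
    have := (tendsto_const_nhds (x := L 0)).div_atTop hLtop |>.const_sub 1
    rw [sub_zero] at this
    refine this.congr' ?_
    filter_upwards [hLpos] with n hn
    field_simp
  have h6 := (((h4.add_const ℓ).mul h5).add ((tendsto_const_nhds (x := u 0)).div_atTop hLtop))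
  simp only [zero_add, mul_one, add_zero] at h6
  refine h6.congr' ?_
  filter_upwards [hLpos, hLpos'] with n hn hn'
  field_simp
  ring

lemma tendsto_mul_log_succ_sub_log :
    Tendsto (fun n : ℕ => (n : ℝ) * (Real.log ((n + 1 : ℕ) : ℝ) - Real.log n)) atTop (𝓝 1) := by
  refine ((Real.tendsto_mul_log_one_add_div_atTop 1).comp tendsto_natCast_atTop_atTop).congr' ?_
  filter_upwards [eventually_gt_atTop 0] with n hn
  have hn' : (0 : ℝ) < n := by exact_mod_cast hn
  rw [← Real.log_div (by positivity) hn'.ne']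
  simp only [Function.comp_apply]
  congr 2
  push_cast
  field_simp

lemma tendsto_log_natCast : Tendsto (fun n : ℕ => Real.log (n : ℝ)) atTop atTop :=
  Real.tendsto_log_atTop.comp tendsto_natCast_atTop_atTop

lemma tendsto_log_succ_div_log :
    Tendsto (fun n : ℕ => Real.log ((n + 1 : ℕ) : ℝ) / Real.log n) atTop (𝓝 1) := by
  have h1 : Tendsto (fun n : ℕ => (n : ℝ) * Real.log n) atTop atTop :=
    tendsto_natCast_atTop_atTop.atTop_mul_atTop₀ tendsto_log_natCast
  have h2 := (tendsto_mul_log_succ_sub_log.div_atTop h1).const_add 1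
  rw [add_zero] at h2
  refine h2.congr' ?_
  filter_upwards [eventually_gt_atTop 0, tendsto_log_natCast.eventually_gt_atTop 0] with n hn hl
  have hn' : (0 : ℝ) < n := by exact_mod_cast hn
  field_simp
  ring

/-- Factoring $x^{k+1}-y^{k+1}$ leaves $n(\log(n+1)-\log n)\to1$ times `k + 1` terms, each tending
to 1 after division by $(\log n)^k$. -/
lemma tendsto_log_pow_diff (k : ℕ) :
    Tendsto (fun n : ℕ => (n : ℝ) * (Real.log ((n + 1 : ℕ) : ℝ) ^ (k + 1) - Real.log n ^ (k + 1)) /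
      Real.log n ^ k) atTop (𝓝 (k + 1)) := by
  have h1 : Tendsto (fun n : ℕ => ∑ i ∈ range (k + 1),
      (Real.log ((n + 1 : ℕ) : ℝ) / Real.log n) ^ i) atTop (𝓝 (∑ i ∈ range (k + 1), (1 : ℝ) ^ i)) :=
    tendsto_finsetSum _ fun i _ => tendsto_log_succ_div_log.pow i
  have h2 := tendsto_mul_log_succ_sub_log.mul h1
  simp only [one_pow, sum_const, card_range, nsmul_eq_mul, mul_one, one_mul] at h2
  push_cast at h2
  refine h2.congr' ?_
  filter_upwards [tendsto_log_natCast.eventually_gt_atTop 0] with n hl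
  push_cast
  rw [← (Commute.all (Real.log ((n : ℝ) + 1)) (Real.log n)).geom_sum₂_mul (k + 1)]
  have h3 : ∑ i ∈ range (k + 1), Real.log ((n : ℝ) + 1) ^ i * Real.log n ^ (k + 1 - 1 - i) =
      Real.log n ^ k * ∑ i ∈ range (k + 1), (Real.log ((n : ℝ) + 1) / Real.log n) ^ i := by
    rw [mul_sum]
    refine sum_congr rfl fun i hi => ?_
    have hik : i ≤ k := Nat.lt_succ_iff.1 (mem_range.1 hi)
    rw [Nat.add_sub_cancel, div_pow, ← Nat.sub_add_cancel hik, pow_add]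
    simp only [Nat.add_sub_cancel]
    field_simp
  rw [h3]
  field_simp

/-- The growth of sequences defined by a Pascal-type recursion with coefficients of order `1/n`. -/
lemma tendsto_div_log_pow {u : ℕ → ℕ → ℝ} {a : ℕ → ℝ} {α C : ℝ}
    (ha : Tendsto (fun n : ℕ => (n : ℝ) * a n) atTop (𝓝 α)) (h0 : ∀ n, u 0 n = C)
    (hu : ∀ k n, u (k + 1) (n + 1) = u (k + 1) n + a n * u k n) (k : ℕ) :
    Tendsto (fun n => u k n / Real.log n ^ k) atTop (𝓝 (C * α ^ k / k.factorial)) := by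
  induction k with
  | zero => simp [h0]
  | succ k ih =>
    have hlog : Monotone fun n : ℕ => Real.log (n : ℝ) := by
      refine monotone_nat_of_le_succ fun n => ?_
      rcases Nat.eq_zero_or_pos n with rfl | hn
      · simp
      · exact Real.log_le_log (by exact_mod_cast hn) (by push_cast; linarith)
    have hL : Monotone fun n : ℕ => Real.log (n : ℝ) ^ (k + 1) := fun m n hmn =>
      pow_le_pow_left₀ (Real.log_natCast_nonneg m) (hlog hmn) _
    have hLtop : Tendsto (fun n : ℕ => Real.log (n : ℝ) ^ (k + 1)) atTop atTop :=
      (tendsto_pow_atTop (Nat.succ_ne_zero k)).comp tendsto_log_natCast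
    have hd := tendsto_log_pow_diff k
    have hpos : ∀ᶠ n : ℕ in atTop,
        0 < Real.log ((n + 1 : ℕ) : ℝ) ^ (k + 1) - Real.log (n : ℝ) ^ (k + 1) := by
      filter_upwards [hd.eventually (lt_mem_nhds (by positivity : (0 : ℝ) < k + 1)),
        tendsto_log_natCast.eventually_gt_atTop 0, eventually_gt_atTop 0] with n hn hl hn0
      have hn' : (0 : ℝ) < n := by exact_mod_cast hn0
      rw [div_pos_iff_of_pos_right (by positivity)] at hn
      exact (mul_pos_iff_of_pos_left hn').1 hn
    refine tendsto_div_of_tendsto_diff_div hL hLtop (hpos.mono fun n hn => hn.ne') ?_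
    -- The increment of `u (k + 1)` is `a n * u k n`. Scaling it and the increment of $(\log
    -- n)^{k+1}$ by $n/(\log n)^k$ gives two convergent factors.
    have h2 := (ha.mul ih).div hd (by positivity)
    have he : α * (C * α ^ k / k.factorial) / ((k : ℝ) + 1) =
        C * α ^ (k + 1) / (k + 1).factorial := by
      rw [Nat.factorial_succ]
      push_cast
      field_simp
      ring
    rw [he] at h2
    refine h2.congr' ?_
    filter_upwards [hpos, tendsto_log_natCast.eventually_gt_atTop 0,
      eventually_gt_atTop 0] with n hn hl hn0
    have hn' : (0 : ℝ) < n := by exact_mod_cast hn0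
    rw [hu k n, add_sub_cancel_left]
    simp only [Pi.div_apply]
    field_simp

/-- The group order grows by the factor $2n+4$, the sum of the weights $2n+3$ and 1, so the
recursion survives passing to complements. -/
lemma missProbB_succ (n d : ℕ) : missProbB (n + 1) d =
    ((2 * n + 3) * missProbB n d + missProbB n (d - 1)) / (2 * n + 4) := by
  rw [missProbB, missProbB, missProbB, regionCount, Nat.factorial_succ (n + 1), pow_succ]
  push_cast
  have : ((n + 1).factorial : ℝ) ≠ 0 := by positivity
  field_simp
  ring

lemma missProbA_succ (n d : ℕ) : missProbA (n + 1) d =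
    ((n + 2) * missProbA n d + missProbA n (d - 1)) / (n + 3) := by
  rw [missProbA, missProbA, missProbA, regionCount, Nat.factorial_succ (n + 2)]
  push_cast
  have : ((n + 2).factorial : ℝ) ≠ 0 := by positivity
  field_simp
  ring

lemma missProbB_zero_right (n : ℕ) : missProbB n 0 = 0 := by
  induction n with
  | zero => norm_num [missProbB, regionCount]
  | succ n ih => simp [missProbB_succ, ih]

lemma missProbA_zero_right (n : ℕ) : missProbA n 0 = 0 := by
  induction n with
  | zero => norm_num [missProbA, regionCount]
  | succ n ih => simp [missProbA_succ, ih]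

/-- `∏_{i ≤ n} (2i - 1) / (2i)`. -/
noncomputable def wallisRatio (n : ℕ) : ℝ := ∏ i ∈ range n, ((2 * i + 1) / (2 * i + 2) : ℝ)

lemma wallisRatio_pos (n : ℕ) : 0 < wallisRatio n := prod_pos fun i _ => by positivity

lemma wallisRatio_succ (n : ℕ) :
    wallisRatio (n + 1) = wallisRatio n * ((2 * n + 1) / (2 * n + 2)) := prod_range_succ _ _

/-- This ties the ratio to the Wallis product, whose limit $\pi/2$ yields the order $1/\sqrt{\pi
n}$. -/
lemma wallisRatio_sq_mul (n : ℕ) : wallisRatio n ^ 2 * ((2 * n + 1) * Real.Wallis.W n) = 1 := by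
  induction n with
  | zero => simp [wallisRatio, Real.Wallis.W]
  | succ n ih =>
    refine Eq.trans ?_ ih
    rw [wallisRatio_succ, Real.Wallis.W_succ]
    push_cast
    field_simp
    ring

lemma tendsto_wallisRatio_mul_sqrt :
    Tendsto (fun n : ℕ => wallisRatio n * √(Real.pi * n)) atTop (𝓝 1) := by
  have h1 : Tendsto (fun n : ℕ => Real.pi * ((n : ℝ) / (2 * n + 1)) / Real.Wallis.W n) atTop
      (𝓝 (Real.pi * (1 / 2) / (Real.pi / 2))) :=
    (Stirling.tendsto_self_div_two_mul_self_add_one.const_mul Real.pi).div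
      Real.Wallis.tendsto_W_nhds_pi_div_two (by positivity)
  have h2 := h1.sqrt
  have h3 : √(Real.pi * (1 / 2) / (Real.pi / 2)) = 1 := by
    rw [mul_one_div, div_self (by positivity), Real.sqrt_one]
  rw [h3] at h2
  refine h2.congr fun n => ?_
  have hW := Real.Wallis.W_pos n
  have hsq := wallisRatio_sq_mul n
  have : Real.pi * ((n : ℝ) / (2 * n + 1)) / Real.Wallis.W n =
      wallisRatio n ^ 2 * (Real.pi * n) := by
    have h4 : wallisRatio n ^ 2 = 1 / ((2 * n + 1) * Real.Wallis.W n) := by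
      rw [eq_div_iff (by positivity), hsq]
    rw [h4]
    field_simp
  rw [this, Real.sqrt_mul (by positivity), Real.sqrt_sq (wallisRatio_pos n).le]

lemma tendsto_log_div_log_succ :
    Tendsto (fun n : ℕ => Real.log n / Real.log ((n + 1 : ℕ) : ℝ)) atTop (𝓝 1) := by
  simpa [inv_div] using tendsto_log_succ_div_log.inv₀ one_ne_zero

lemma tendsto_mul_add_inv (b c : ℝ) (hb : b ≠ 0) :
    Tendsto (fun n : ℕ => (n : ℝ) * (1 / (b * n + c))) atTop (𝓝 (1 / b)) := by
  have h0 : Tendsto (fun n : ℕ => c / (n : ℝ)) atTop (𝓝 0) :=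
    tendsto_const_nhds.div_atTop tendsto_natCast_atTop_atTop
  have h := (h0.const_add b).inv₀ (by simpa using hb)
  rw [add_zero] at h
  rw [one_div]
  refine h.congr' ?_
  filter_upwards [eventually_gt_atTop 0] with n hn
  have hn' : (n : ℝ) ≠ 0 := by exact_mod_cast hn.ne'
  have : b + c / n = (b * n + c) / n := by field_simp
  rw [this, inv_div, mul_one_div]

/-- Asymptotics of `missProbB`. -/
theorem tendsto_missProbB (k : ℕ) :
    Tendsto (fun n : ℕ => missProbB n (k + 1) * √(Real.pi * (n + 1 : ℕ)) /
      Real.log ((n + 1 : ℕ) : ℝ) ^ k) atTop (𝓝 (2 * (1 / 2) ^ k / k.factorial)) := by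
  -- `wallisRatio (n + 1)` solves the homogeneous recursion, its ratio of consecutive terms being
  -- $(2n+3)/(2n+4)$. Dividing by it makes the leading coefficient 1. The constant `C = 2` comes
  -- from dimension one.
  have h := tendsto_div_log_pow (u := fun k n => missProbB n (k + 1) / wallisRatio (n + 1))
    (a := fun n => 1 / (2 * n + 3)) (α := 1 / 2) (C := 2) (tendsto_mul_add_inv 2 3 two_ne_zero)
    ?_ ?_ k
  · have h2 := (h.mul (tendsto_wallisRatio_mul_sqrt.comp (tendsto_add_atTop_nat 1))).mul
      (tendsto_log_div_log_succ.pow k)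
    simp only [mul_one, one_pow] at h2
    refine h2.congr' ?_
    filter_upwards [tendsto_log_natCast.eventually_gt_atTop 0] with n hn
    have := wallisRatio_pos (n + 1)
    simp only [Function.comp_apply, div_pow]
    field_simp
  · intro n
    have : ∀ n, missProbB n 1 = 2 * wallisRatio (n + 1) := by
      intro n
      induction n with
      | zero => norm_num [missProbB, regionCount, wallisRatio]
      | succ n ih =>
        rw [missProbB_succ, missProbB_zero_right, ih, wallisRatio_succ (n + 1)]
        push_cast
        field_simp
        ring
    rw [zero_add, this, mul_div_cancel_right₀ _ (wallisRatio_pos _).ne']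
  · intro k n
    have := wallisRatio_pos (n + 1)
    rw [missProbB_succ, wallisRatio_succ (n + 1), Nat.add_sub_cancel]
    push_cast
    field_simp
    ring

/-- Asymptotics of `missProbA`. -/
theorem tendsto_missProbA (k : ℕ) :
    Tendsto (fun n : ℕ => missProbA n (k + 1) * ((n + 2 : ℕ) : ℝ) /
      Real.log ((n + 2 : ℕ) : ℝ) ^ k) atTop (𝓝 (2 / k.factorial)) := by
  have h := tendsto_div_log_pow (u := fun k n => missProbA n (k + 1) * ((n + 2 : ℕ) : ℝ))
    (a := fun n => 1 / (1 * n + 2)) (α := 1 / 1) (C := 2) (tendsto_mul_add_inv 1 2 one_ne_zero)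
    ?_ ?_ k
  · have h2 := (h.mul (tendsto_log_div_log_succ.pow k)).mul
      ((tendsto_log_div_log_succ.comp (tendsto_add_atTop_nat 1)).pow k)
    simp only [mul_one, one_pow, div_one] at h2
    refine h2.congr' ?_
    filter_upwards [tendsto_log_natCast.eventually_gt_atTop 0,
      (tendsto_log_natCast.comp (tendsto_add_atTop_nat 1)).eventually_gt_atTop 0] with n hn hn'
    simp only [Function.comp_apply] at hn' ⊢
    have e : n + 1 + 1 = n + 2 := rfl
    rw [e, div_pow, div_pow]
    field_simp
  · intro n
    have : ∀ n, missProbA n 1 = 2 / ((n + 2 : ℕ) : ℝ) := by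
      intro n
      induction n with
      | zero => norm_num [missProbA, regionCount]
      | succ n ih =>
        rw [missProbA_succ, missProbA_zero_right, ih]
        push_cast
        field_simp
        ring
    rw [zero_add, this, div_mul_cancel₀]
    positivity
  · intro k n
    rw [missProbA_succ, Nat.add_sub_cancel]
    push_cast
    field_simp
    ring

lemma limit_constant_eq_one (j : ℕ) :
    2 * (1 / 2 : ℝ) ^ (j + 1) / (j + 1).factorial * (2 ^ j * (j + 1).factorial) = 1 := by
  have : ((j + 1).factorial : ℝ) ≠ 0 := by positivity
  rw [one_div, inv_pow, pow_succ]
  field_simp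

/-- After normalisation both terms have the same limit $\ell$, so the difference tends to
$2\ell-\ell=\ell$: cases B and D agree asymptotically. -/
lemma tendsto_missProbB_diff (k : ℕ) :
    Tendsto (fun n : ℕ => (2 * missProbB (n + 1) (k + 1) - missProbB n (k + 1)) *
      √(Real.pi * (n + 2 : ℕ)) / Real.log ((n + 2 : ℕ) : ℝ) ^ k) atTop
      (𝓝 (2 * (1 / 2) ^ k / k.factorial)) := by
  have h1 := (tendsto_missProbB k).comp (tendsto_add_atTop_nat 1)
  have h2 : Tendsto (fun n : ℕ => √(((n + 2 : ℕ) : ℝ) / (n + 1 : ℕ))) atTop (𝓝 1) := by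
    have h3 : Tendsto (fun n : ℕ => 1 + 1 / ((n : ℝ) + 1)) atTop (𝓝 (1 + 0)) :=
      tendsto_one_div_add_atTop_nhds_zero_nat.const_add 1
    have h4 := h3.sqrt
    rw [add_zero, Real.sqrt_one] at h4
    refine h4.congr fun n => ?_
    congr 1
    push_cast
    field_simp
    ring
  have h5 := ((tendsto_missProbB k).mul h2).mul
    ((tendsto_log_div_log_succ.comp (tendsto_add_atTop_nat 1)).pow k)
  have h6 := (h1.const_mul 2).sub h5
  simp only [mul_one, one_pow] at h6
  rw [two_mul, add_sub_cancel_right] at h6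
  refine h6.congr' ?_
  filter_upwards [(tendsto_log_natCast.comp (tendsto_add_atTop_nat 1)).eventually_gt_atTop 0,
    (tendsto_log_natCast.comp (tendsto_add_atTop_nat 2)).eventually_gt_atTop 0] with n hl hl'
  simp only [Function.comp_apply] at hl hl' ⊢
  have e : n + 1 + 1 = n + 2 := rfl
  have hsqrt : √(Real.pi * ((n + 2 : ℕ) : ℝ)) =
      √(Real.pi * ((n + 1 : ℕ) : ℝ)) * √(((n + 2 : ℕ) : ℝ) / (n + 1 : ℕ)) := by
    rw [← Real.sqrt_mul (by positivity)]
    congr 1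
    field_simp
  rw [e, hsqrt, div_pow]
  field_simp

end Asymptotics

end WalkHull

/-! ### Conclusion: the three limits from the exact formulas. -/

theorem theorem5p1 (d : ℕ) (hd : 2 ≤ d)
    (Ω : ℕ → Type*) [∀ n, MeasurableSpace (Ω n)]
    (P : ∀ n, MeasureTheory.Measure (Ω n)) [∀ n, MeasureTheory.IsProbabilityMeasure (P n)]
    (ξ : ∀ n, Fin n → Ω n → EuclideanSpace ℝ (Fin d)) :
    ((∀ᶠ n in Filter.atTop, WalkHull.TypeA (P n) (ξ n)) →
      Filter.Tendsto
        (fun n : ℕ => (P n).real {ω | 0 ∉ WalkHull.hullA (ξ n) ω} /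
          (2 * Real.log (n : ℝ) ^ (d - 1) / ((Nat.factorial (d - 1) : ℝ) * (n : ℝ))))
        Filter.atTop (nhds 1)) ∧
    ((∀ᶠ n in Filter.atTop, WalkHull.TypeB (P n) (ξ n)) →
      Filter.Tendsto
        (fun n : ℕ => (P n).real {ω | 0 ∉ WalkHull.hullB (ξ n) ω} /
          (Real.log (n : ℝ) ^ (d - 1) /
            (2 ^ (d - 2) * (Nat.factorial (d - 1) : ℝ) * Real.sqrt (Real.pi * (n : ℝ)))))
        Filter.atTop (nhds 1)) ∧
    ((∀ᶠ n in Filter.atTop, WalkHull.TypeD (P n) (ξ n)) →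
      Filter.Tendsto
        (fun n : ℕ => (P n).real {ω | 0 ∉ WalkHull.hullD (ξ n) ω} /
          (Real.log (n : ℝ) ^ (d - 1) /
            (2 ^ (d - 2) * (Nat.factorial (d - 1) : ℝ) * Real.sqrt (Real.pi * (n : ℝ)))))
        Filter.atTop (nhds 1)) := by
  obtain ⟨j, rfl⟩ : ∃ j, d = j + 2 := ⟨d - 2, by omega⟩
  have hlog : ∀ m : ℕ, ∀ᶠ n : ℕ in Filter.atTop, 0 < Real.log ((n + m : ℕ) : ℝ) := fun m =>
    (WalkHull.tendsto_log_natCast.comp (Filter.tendsto_add_atTop_nat m)).eventually_gt_atTop 0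
  refine ⟨fun hA => ?_, fun hB => ?_, fun hD => ?_⟩
  · rw [← Filter.tendsto_add_atTop_iff_nat 2]
    have h := (WalkHull.tendsto_missProbA (j + 1)).mul_const (((j + 1).factorial : ℝ) / 2)
    rw [div_mul_div_cancel₀ (by positivity), div_self two_ne_zero] at h
    refine h.congr' ?_
    filter_upwards [(Filter.tendsto_add_atTop_nat 2).eventually hA, hlog 2] with n hn hl
    rw [hn.measureReal_eq, show j + 2 - 1 = j + 1 from rfl]
    field_simp
  · rw [← Filter.tendsto_add_atTop_iff_nat 1]
    have h := (WalkHull.tendsto_missProbB (j + 1)).mul_const (2 ^ j * ((j + 1).factorial : ℝ))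
    rw [WalkHull.limit_constant_eq_one] at h
    refine h.congr' ?_
    filter_upwards [(Filter.tendsto_add_atTop_nat 1).eventually hB, hlog 1] with n hn hl
    rw [hn.measureReal_eq, show j + 2 - 1 = j + 1 from rfl, show j + 2 - 2 = j from rfl]
    field_simp
  · rw [← Filter.tendsto_add_atTop_iff_nat 2]
    have h := (WalkHull.tendsto_missProbB_diff (j + 1)).mul_const (2 ^ j * ((j + 1).factorial : ℝ))
    rw [WalkHull.limit_constant_eq_one] at h
    refine h.congr' ?_
    filter_upwards [(Filter.tendsto_add_atTop_nat 2).eventually hD, hlog 2,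
      -- This bound supplies `d ≤ n + 1`, needed because the walk without its last step must itself
      -- be of type B.
      Filter.eventually_ge_atTop (j + 1)] with n hn hl hj
    rw [hn.measureReal_eq (by omega), show j + 2 - 1 = j + 1 from rfl,
      show j + 2 - 2 = j from rfl]
    field_simp
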